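/- For $a>0$ let $K_a$ be the integral operator on $L^2(\mathbb{R})$ given by $$(K_af)(x)=\int_{-\infty}^{\infty}K_a(x,y)f(y)\,dy,\qquad K_a(x,y)=\frac1\pi\cdot\frac1{1+(x-y)^2+a^2(x^2+y^2)^2}.$$ The closed subspaces $H^e$ and $H^o$ of even and of odd functions in $L^2(\mathbb{R})$ are invariant under $K_a$. Then there is $a_0>0$ such that for every $a$ with $0<a<a_0$ the following holds. All eigenvalues of $K_a$, of $K_a|H^e$ and of $K_a|H^o$ are real, and each of these three operators has a largest eigenvalue; denote them by $E(a)$, $E^e(a)$ and $E^o(a)$, respectively. Moreover $E(a)=\|K_a\|$, and $$3a^{2/5}\;\geq\;1-E^o(a)\;>\;1-E^e(a)\;=\;1-E(a)\;\geq\;\frac1{12}\,a^{2/5}.$$ -/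

import Mathlib

open MeasureTheory
open scoped ENNReal

noncomputable section

namespace AnisotropicKernel

/-- The complex Hilbert space `L²(ℝ)` with respect to Lebesgue measure. -/
abbrev L2 : Type := Lp ℂ 2 (volume : Measure ℝ)

/-- The anisotropic kernel `(1/π) · 1 / (1 + (x - y)² + a² (x² + y²)²)`. -/
def kernel (a x y : ℝ) : ℝ :=
  1 / Real.pi * (1 / (1 + (x - y) ^ 2 + a ^ 2 * (x ^ 2 + y ^ 2) ^ 2))

theorem kernel_nonneg (a x y : ℝ) : 0 ≤ kernel a x y := by
  have := Real.pi_pos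
  unfold kernel
  positivity

theorem kernel_symm (a x y : ℝ) : kernel a x y = kernel a y x := by
  unfold kernel
  ring_nf

theorem kernel_continuous (a : ℝ) : Continuous fun p : ℝ × ℝ => kernel a p.1 p.2 := by
  unfold kernel
  refine continuous_const.mul (Continuous.div continuous_const (by fun_prop) fun p => ?_)
  positivity

theorem kernel_le_cauchy (a x y : ℝ) :
    kernel a x y ≤ ProbabilityTheory.cauchyPDFReal x 1 y := by
  have := Real.pi_pos
  rw [ProbabilityTheory.cauchyPDFReal_def]
  unfold kernel
  have h : 1 / (1 + (x - y) ^ 2 + a ^ 2 * (x ^ 2 + y ^ 2) ^ 2) ≤ 1 / (1 + (x - y) ^ 2) := by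
    apply one_div_le_one_div_of_le <;> nlinarith [sq_nonneg (x - y), sq_nonneg (a * (x ^ 2 + y ^ 2))]
  calc _ ≤ 1 / Real.pi * (1 / (1 + (x - y) ^ 2)) := by gcongr
    _ = _ := by simp; ring

theorem kernel_le_one (a x y : ℝ) : kernel a x y ≤ 1 := by
  have h1 : 1 / Real.pi ≤ 1 := by
    rw [div_le_one Real.pi_pos]; linarith [Real.pi_gt_three]
  have h2 : 1 / (1 + (x - y) ^ 2 + a ^ 2 * (x ^ 2 + y ^ 2) ^ 2) ≤ 1 := by
    rw [div_le_one (by positivity)]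
    nlinarith [sq_nonneg (x - y), sq_nonneg (a * (x ^ 2 + y ^ 2))]
  unfold kernel
  exact mul_le_one₀ h1 (by positivity) h2

theorem lintegral_kernel_le (a x : ℝ) : ∫⁻ y, ENNReal.ofReal (kernel a x y) ≤ 1 := by
  calc ∫⁻ y, ENNReal.ofReal (kernel a x y)
      ≤ ∫⁻ y, ProbabilityTheory.cauchyPDF x 1 y := by
        refine lintegral_mono fun y => ?_
        rw [ProbabilityTheory.cauchyPDF]
        exact ENNReal.ofReal_le_ofReal (kernel_le_cauchy a x y)
    _ = 1 := ProbabilityTheory.lintegral_cauchyPDF_eq_one x one_ne_zero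

theorem measurable_ofReal_kernel (a : ℝ) :
    Measurable fun p : ℝ × ℝ => ENNReal.ofReal (kernel a p.1 p.2) :=
  (kernel_continuous a).measurable.ennreal_ofReal

theorem memLp_kernel (a x : ℝ) : MemLp (fun y => (kernel a x y : ℂ)) 2 volume := by
  have hc : Continuous fun y => kernel a x y :=
    (kernel_continuous a).comp (Continuous.prodMk_right x)
  have hm : AEStronglyMeasurable (fun y => (kernel a x y : ℂ)) volume :=
    (Complex.continuous_ofReal.comp hc).aestronglyMeasurable
  have h1 : Integrable (fun y => kernel a x y) volume := by
    refine ⟨hc.aestronglyMeasurable, lt_of_le_of_lt ?_ ENNReal.one_lt_top⟩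
    refine le_trans (le_of_eq (lintegral_congr fun y => ?_)) (lintegral_kernel_le a x)
    rw [← ofReal_norm, Real.norm_of_nonneg (kernel_nonneg a x y)]
  rw [memLp_two_iff_integrable_sq_norm hm]
  refine h1.mono (hm.norm.pow 2) (Filter.Eventually.of_forall fun y => ?_)
  have h0 := kernel_nonneg a x y
  rw [Complex.norm_real, Real.norm_of_nonneg h0, Real.norm_of_nonneg (sq_nonneg _), sq]
  exact mul_le_of_le_one_left h0 (kernel_le_one a x y)

/-- The function `x ↦ ∫ K_a(x, y) f(y) dy`. -/
def kernelIntegral (a : ℝ) (f : ℝ → ℂ) (x : ℝ) : ℂ := ∫ y, (kernel a x y : ℂ) * f y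

theorem integrable_kernel_mul (a x : ℝ) (f : L2) :
    Integrable (fun y => (kernel a x y : ℂ) * f y) volume :=
  (memLp_kernel a x).integrable_mul (Lp.memLp f)

theorem enorm_kernelIntegral_sq_le (a : ℝ) (f : L2) (x : ℝ) :
    ‖kernelIntegral a f x‖ₑ ^ (2 : ℝ) ≤
      ∫⁻ y, ENNReal.ofReal (kernel a x y) * ‖f y‖ₑ ^ (2 : ℝ) := by
  have hk : Measurable fun y => ENNReal.ofReal (kernel a x y) :=
    ((kernel_continuous a).comp (Continuous.prodMk_right x)).measurable.ennreal_ofReal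
  have hf : AEMeasurable (fun y => ‖f y‖ₑ) volume :=
    (Lp.stronglyMeasurable f).measurable.enorm.aemeasurable
  have h1 : ‖kernelIntegral a f x‖ₑ ≤ ∫⁻ y, ((fun y => ENNReal.ofReal (kernel a x y) ^ (1 / 2 : ℝ)) *
      (fun y => ENNReal.ofReal (kernel a x y) ^ (1 / 2 : ℝ) * ‖f y‖ₑ)) y := by
    refine (enorm_integral_le_lintegral_enorm _).trans (le_of_eq (lintegral_congr fun y => ?_))
    rw [Pi.mul_apply, ← mul_assoc, ← ENNReal.rpow_add_of_nonneg _ _ (by norm_num) (by norm_num), enorm_mul,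
      ← ofReal_norm, Complex.norm_real, Real.norm_of_nonneg (kernel_nonneg a x y)]
    norm_num
  have h2 := ENNReal.lintegral_mul_le_Lp_mul_Lq volume Real.HolderConjugate.two_two
    (hk.pow_const (1 / 2 : ℝ)).aemeasurable ((hk.pow_const (1 / 2 : ℝ)).aemeasurable.mul hf)
  have h3 := ENNReal.rpow_le_rpow (h1.trans h2) (show (0 : ℝ) ≤ 2 by norm_num)
  refine h3.trans ?_
  rw [ENNReal.mul_rpow_of_nonneg _ _ (by norm_num), ← ENNReal.rpow_mul, ← ENNReal.rpow_mul]
  simp only [Pi.mul_apply, ENNReal.mul_rpow_of_nonneg _ _ (show (0 : ℝ) ≤ 2 by norm_num),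
    ← ENNReal.rpow_mul]
  norm_num
  exact mul_le_of_le_one_left zero_le (lintegral_kernel_le a x)

theorem lintegral_kernelIntegral_sq_le (a : ℝ) (f : L2) :
    ∫⁻ x, ‖kernelIntegral a f x‖ₑ ^ (2 : ℝ) ≤ ∫⁻ y, ‖f y‖ₑ ^ (2 : ℝ) := by
  have hf : Measurable (fun y => ‖f y‖ₑ) := (Lp.stronglyMeasurable f).measurable.enorm
  calc _ ≤ ∫⁻ x, ∫⁻ y, ENNReal.ofReal (kernel a x y) * ‖f y‖ₑ ^ (2 : ℝ) :=
        lintegral_mono fun x => enorm_kernelIntegral_sq_le a f x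
    _ = ∫⁻ y, ∫⁻ x, ENNReal.ofReal (kernel a x y) * ‖f y‖ₑ ^ (2 : ℝ) := by
        refine lintegral_lintegral_swap (Measurable.aemeasurable ?_)
        exact (measurable_ofReal_kernel a).mul ((hf.comp measurable_snd).pow_const _)
    _ ≤ _ := by
        refine lintegral_mono fun y => ?_
        have hm : Measurable fun x => ENNReal.ofReal (kernel a x y) :=
          ((kernel_continuous a).comp (Continuous.prodMk_left y)).measurable.ennreal_ofReal
        dsimp only
        rw [lintegral_mul_const _ hm]
        refine mul_le_of_le_one_left zero_le ?_
        simp_rw [kernel_symm a _ y]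
        exact lintegral_kernel_le a y

theorem eLpNorm_kernelIntegral_le (a : ℝ) (f : L2) :
    eLpNorm (kernelIntegral a f) 2 volume ≤ eLpNorm f 2 volume := by
  rw [eLpNorm_eq_lintegral_rpow_enorm_toReal two_ne_zero ENNReal.ofNat_ne_top,
    eLpNorm_eq_lintegral_rpow_enorm_toReal two_ne_zero ENNReal.ofNat_ne_top]
  simp only [ENNReal.toReal_ofNat]
  exact ENNReal.rpow_le_rpow (lintegral_kernelIntegral_sq_le a f) (by norm_num)

theorem memLp_kernelIntegral (a : ℝ) (f : L2) : MemLp (kernelIntegral a f) 2 volume := by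
  refine ⟨?_, (eLpNorm_kernelIntegral_le a f).trans_lt (Lp.memLp f).2⟩
  have h : StronglyMeasurable fun p : ℝ × ℝ => (kernel a p.1 p.2 : ℂ) * f p.2 :=
    (Complex.continuous_ofReal.comp (kernel_continuous a)).stronglyMeasurable.mul
      ((Lp.stronglyMeasurable f).comp_measurable measurable_snd)
  exact h.integral_prod_right'.aestronglyMeasurable

/-- The integral operator `(K_a f)(x) = ∫ K_a(x, y) f(y) dy`, a bounded operator on `L²(ℝ)`. -/
def operator (a : ℝ) : L2 →L[ℂ] L2 :=
  LinearMap.mkContinuous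
    { toFun := fun f => (memLp_kernelIntegral a f).toLp (kernelIntegral a f)
      map_add' := fun f g => by
        rw [← MemLp.toLp_add]
        refine MemLp.toLp_congr _ _ (Filter.Eventually.of_forall fun x => ?_)
        simp only [kernelIntegral, Pi.add_apply]
        rw [← integral_add (integrable_kernel_mul a x f) (integrable_kernel_mul a x g)]
        refine integral_congr_ae ?_
        filter_upwards [Lp.coeFn_add f g] with y hy
        rw [hy, Pi.add_apply, mul_add]
      map_smul' := fun c f => by
        rw [RingHom.id_apply, ← MemLp.toLp_const_smul]
        refine MemLp.toLp_congr _ _ (Filter.Eventually.of_forall fun x => ?_)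
        simp only [kernelIntegral, Pi.smul_apply, smul_eq_mul]
        rw [← integral_const_mul]
        refine integral_congr_ae ?_
        filter_upwards [Lp.coeFn_smul c f] with y hy
        rw [hy, Pi.smul_apply, smul_eq_mul]
        ring }
    1 fun f => by
      rw [one_mul, LinearMap.coe_mk, AddHom.coe_mk, Lp.norm_toLp, Lp.norm_def]
      exact ENNReal.toReal_mono (Lp.memLp f).2.ne (eLpNorm_kernelIntegral_le a f)

theorem operator_ae_eq (a : ℝ) (f : L2) :
    operator a f =ᵐ[volume] fun x => ∫ y, (kernel a x y : ℂ) * f y :=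
  MemLp.coeFn_toLp (memLp_kernelIntegral a f)

theorem ae_neg {p : ℝ → Prop} (h : ∀ᵐ x, p x) : ∀ᵐ x : ℝ, p (-x) :=
  (Measure.measurePreserving_neg (volume : Measure ℝ)).quasiMeasurePreserving.ae h

/-- For `ε = 1` the subspace of even functions in `L²(ℝ)`, for `ε = -1` that of odd functions. -/
def paritySubspace (ε : ℂ) : Submodule ℂ L2 where
  carrier := {f | ∀ᵐ x : ℝ, f (-x) = ε * f x}
  zero_mem' := by
    have h := Lp.coeFn_zero ℂ 2 (volume : Measure ℝ)
    filter_upwards [h, ae_neg h] with x h1 h2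
    rw [h1, h2]; simp
  add_mem' := fun {f g} hf hg => by
    change ∀ᵐ x : ℝ, (f + g : L2) (-x) = ε * (f + g : L2) x
    have h := Lp.coeFn_add f g
    filter_upwards [h, ae_neg h, hf, hg] with x h1 h2 h3 h4
    rw [h1, h2, Pi.add_apply, Pi.add_apply, h3, h4, mul_add]
  smul_mem' := fun c f hf => by
    change ∀ᵐ x : ℝ, (c • f : L2) (-x) = ε * (c • f : L2) x
    have h := Lp.coeFn_smul c f
    filter_upwards [h, ae_neg h, hf] with x h1 h2 h3
    rw [h1, h2, Pi.smul_apply, Pi.smul_apply, h3, smul_eq_mul, smul_eq_mul]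
    ring

/-- The subspace `H^e` of even functions. -/
def evenSubspace : Submodule ℂ L2 := paritySubspace 1

/-- The subspace `H^o` of odd functions. -/
def oddSubspace : Submodule ℂ L2 := paritySubspace (-1)

theorem operator_mem_paritySubspace (a : ℝ) (ε : ℂ) :
    ∀ f ∈ paritySubspace ε, operator a f ∈ paritySubspace ε := by
  intro f hf
  change ∀ᵐ x : ℝ, operator a f (-x) = ε * operator a f x
  have h := operator_ae_eq a f
  filter_upwards [h, ae_neg h] with x h1 h2
  rw [h1, h2, ← integral_neg_eq_self, ← integral_const_mul]
  refine integral_congr_ae ?_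
  have hf' : ∀ᵐ x : ℝ, f (-x) = ε * f x := hf
  filter_upwards [hf'] with y hy
  have hk : kernel a (-x) (-y) = kernel a x y := by unfold kernel; ring_nf
  rw [hy, hk]
  ring

/-- The restriction `K_a | H^e`. -/
def evenOperator (a : ℝ) : Module.End ℂ evenSubspace :=
  (operator a).toLinearMap.restrict (operator_mem_paritySubspace a 1)

/-- The restriction `K_a | H^o`. -/
def oddOperator (a : ℝ) : Module.End ℂ oddSubspace :=
  (operator a).toLinearMap.restrict (operator_mem_paritySubspace a (-1))

/-- `E` is the largest eigenvalue of `T` (all eigenvalues of `T` being real). -/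
def IsLargestEigenvalue {V : Type*} [AddCommGroup V] [Module ℂ V] (T : Module.End ℂ V)
    (E : ℝ) : Prop :=
  T.HasEigenvalue (E : ℂ) ∧ ∀ μ : ℂ, T.HasEigenvalue μ → μ.im = 0 ∧ μ.re ≤ E

end AnisotropicKernel

end

/-!
On the length scale `a^(-2/5)` the operator `1 - K_a` looks like `a^(2/5) (|p| + 2 x⁴)`: the
convolution with the Poisson kernel `P(u) = 1 / (π (1 + u²))` costs `|p|`, and the quartic term in
the denominator costs `2 a² x⁴`. The two numerical bounds are estimates of the bottom of the
spectrum of this operator, on all of `L²(ℝ)` and on the odd functions. Throughout, `r = a^(2/5)`,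
so that `a² = r⁵`.

*Existence and ordering.* `K_a` is symmetric and Hilbert–Schmidt, hence compact, so on each closed
invariant subspace where its quadratic form takes a positive value the supremum of the Rayleigh
quotient is an eigenvalue (`exists_top_eigenvector`). Since the kernel is positive, replacing `f` by
`|f|` does not decrease the form, and for odd `f ≠ 0` it increases it strictly, because the
contributions of `y` and `-y` to `K_a f` partly cancel (`re_inner_operator_lt_abs_of_odd`). As
`|f|` is then even, `E^o < E^e`; orthogonality of the even and odd functions gives `E = E^e`, and
`|⟨K_a f, f⟩| ≤ ⟨K_a |f|, |f|⟩` gives `E = ‖K_a‖` (`exists_largest_eigenvalues`).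

*Bound on `E` from above.* A positive `h ∈ L²` with `K_a h ≤ c h` pointwise forces every eigenvalue
to be at most `c` (`eigenvalue_le_of_integral_kernel_mul_le`). Take `h(y) = 1 / (y² + β²)` with
`β = 4 / r`. The semigroup property of the Poisson kernels gives `P * h` explicitly
(`integral_poisson_mul_inv`), and this beats `h` for `|x| ≤ β / 2`; for `|x| ≥ β / 2` the quartic
term removes enough mass near the diagonal (`integral_kernel_mul_inv_le`).

*Bound on `E^o` from below.* The trial function is `x ↦ g(x / β)` with `g(s) = s / (1 + s²)³` and
`β = 9 / (10 r)`. The divided difference of `g` is rational, so its Dirichlet-type energy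
`∬ ((g(s) - g(t)) / (s - t))²` is a finite combination of the moments `∫ x^k / (1 + x²)⁶`
(`integral_profileSlope_sq`). With the pointwise estimate `kernel_mul_ge` this gives
`1 - E^o ≤ (2.943... + O(r²)) r`, which is below `3 r` for small `r`.
-/

noncomputable section

namespace AnisotropicKernel

open Filter Topology InnerProductSpace

/-! ### Compact symmetric operators -/

section Abstract

variable {H : Type*} [NormedAddCommGroup H] [InnerProductSpace ℂ H]

/-- Cauchy–Schwarz for the semi-inner product of an operator that is nonnegative on an invariant
subspace: vectors almost minimising the form are almost in the kernel. -/
theorem norm_sq_le_of_nonneg_form {B : H →L[ℂ] H} (hB : B.toLinearMap.IsSymmetric)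
    {V : Submodule ℂ H} (hBV : ∀ v ∈ V, B v ∈ V)
    (hpos : ∀ v ∈ V, 0 ≤ (inner ℂ (B v) v).re) {M : ℝ} (hM : 0 < M) (hBM : ‖B‖ ≤ M)
    {v : H} (hv : v ∈ V) : ‖B v‖ ^ 2 ≤ M * (inner ℂ (B v) v).re := by
  set w := B v with hw
  have hwV : w ∈ V := hBV v hv
  -- positivity of the form at `v - M⁻¹ w` gives the claim after expansion
  have h0 := hpos (v - ((M⁻¹ : ℝ) : ℂ) • w) (V.sub_mem hv (V.smul_mem _ hwV))
  have hsym : inner ℂ (B w) v = inner ℂ w w := hB w v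
  have h2 : (inner ℂ (B w) w).re ≤ M * ‖w‖ ^ 2 := by
    calc (inner ℂ (B w) w).re ≤ ‖inner ℂ (B w) w‖ := Complex.re_le_norm _
      _ ≤ ‖B w‖ * ‖w‖ := norm_inner_le_norm _ _
      _ ≤ (M * ‖w‖) * ‖w‖ := by
          gcongr
          exact (B.le_opNorm w).trans (by gcongr)
      _ = _ := by ring
  have hww : (inner ℂ w w : ℂ) = ((‖w‖ ^ 2 : ℝ) : ℂ) := by
    rw [inner_self_eq_norm_sq_to_K]; simp
  rw [map_sub, map_smul, inner_sub_left, inner_sub_right, inner_sub_right, inner_smul_left,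
    inner_smul_left, inner_smul_right, inner_smul_right, hsym, ← hw, hww] at h0
  simp only [Complex.conj_ofReal, Complex.sub_re, Complex.re_ofReal_mul, Complex.ofReal_re] at h0
  have h3 : M⁻¹ * (M⁻¹ * (inner ℂ (B w) w).re) ≤ M⁻¹ * ‖w‖ ^ 2 := by
    calc M⁻¹ * (M⁻¹ * (inner ℂ (B w) w).re) ≤ M⁻¹ * (M⁻¹ * (M * ‖w‖ ^ 2)) := by gcongr
      _ = _ := by field_simp
  have h4 : M⁻¹ * ‖w‖ ^ 2 ≤ (inner ℂ w v).re := by linarith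
  calc ‖w‖ ^ 2 = M * (M⁻¹ * ‖w‖ ^ 2) := by field_simp
    _ ≤ _ := by gcongr

/-- On a closed invariant subspace where the form of a compact symmetric operator is somewhere
positive, the supremum of the Rayleigh quotient is an eigenvalue. -/
theorem exists_top_eigenvector {T : H →L[ℂ] H} (hT : T.toLinearMap.IsSymmetric)
    (hc : IsCompactOperator T) {V : Submodule ℂ H} (hV : IsClosed (V : Set H))
    (hTV : ∀ v ∈ V, T v ∈ V) (hpos : ∃ v ∈ V, 0 < (inner ℂ (T v) v).re) :
    ∃ E : ℝ, 0 < E ∧ (∃ v ∈ V, v ≠ 0 ∧ T v = (E : ℂ) • v) ∧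
      ∀ v ∈ V, (inner ℂ (T v) v).re ≤ E * ‖v‖ ^ 2 := by
  set S : Set ℝ := {r | ∃ v ∈ V, ‖v‖ = 1 ∧ (inner ℂ (T v) v).re = r} with hS
  have hscale : ∀ (c : ℝ) (v : H),
      (inner ℂ (T ((c : ℂ) • v)) ((c : ℂ) • v)).re = c ^ 2 * (inner ℂ (T v) v).re := by
    intro c v
    rw [map_smul, inner_smul_left, inner_smul_right, Complex.conj_ofReal, Complex.re_ofReal_mul,
      Complex.re_ofReal_mul]
    ring
  have hunit : ∀ v ∈ V, v ≠ 0 → ‖v‖⁻¹ ^ 2 * (inner ℂ (T v) v).re ∈ S := by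
    intro v hv hv0
    refine ⟨((‖v‖⁻¹ : ℝ) : ℂ) • v, V.smul_mem _ hv, ?_, hscale _ _⟩
    rw [norm_smul, Complex.norm_real, norm_inv, norm_norm, inv_mul_cancel₀ (norm_ne_zero_iff.2 hv0)]
  have hbdd : BddAbove S := by
    refine ⟨‖T‖, ?_⟩
    rintro r ⟨v, -, hv1, rfl⟩
    calc (inner ℂ (T v) v).re ≤ ‖inner ℂ (T v) v‖ := Complex.re_le_norm _
      _ ≤ ‖T v‖ * ‖v‖ := norm_inner_le_norm _ _
      _ ≤ _ := by simpa [hv1] using T.le_opNorm v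
  obtain ⟨v₀, hv₀, hv₀pos⟩ := hpos
  have hv₀0 : v₀ ≠ 0 := by rintro rfl; simp at hv₀pos
  have hne : S.Nonempty := ⟨_, hunit v₀ hv₀ hv₀0⟩
  set E := sSup S with hE
  have hEpos : 0 < E := lt_of_lt_of_le (by positivity) (le_csSup hbdd (hunit v₀ hv₀ hv₀0))
  have hle : ∀ v ∈ V, (inner ℂ (T v) v).re ≤ E * ‖v‖ ^ 2 := by
    intro v hv
    rcases eq_or_ne v 0 with rfl | hv0
    · simp
    have h := le_csSup hbdd (hunit v hv hv0)
    have hn : 0 < ‖v‖ ^ 2 := by positivity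
    rw [inv_pow, inv_mul_le_iff₀ hn] at h
    linarith
  refine ⟨E, hEpos, ?_, hle⟩
  obtain ⟨r, -, hr, hrS⟩ := exists_seq_tendsto_sSup hne hbdd
  choose v hvV hv1 hvr using hrS
  set B : H →L[ℂ] H := (E : ℂ) • ContinuousLinearMap.id ℂ H - T with hB
  have hBapp : ∀ u, B u = (E : ℂ) • u - T u := fun u => rfl
  have hBform : ∀ u, (inner ℂ (B u) u).re = E * ‖u‖ ^ 2 - (inner ℂ (T u) u).re := by
    intro u
    rw [hBapp, inner_sub_left, inner_smul_left, inner_self_eq_norm_sq_to_K, Complex.conj_ofReal,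
      Complex.sub_re, Complex.re_ofReal_mul]
    norm_cast
  have hBsym : B.toLinearMap.IsSymmetric := by
    intro x y
    change inner ℂ (B x) y = inner ℂ x (B y)
    rw [hBapp, hBapp, inner_sub_left, inner_sub_right, inner_smul_left, inner_smul_right,
      Complex.conj_ofReal]
    congr 1
    exact hT x y
  -- a maximising sequence of unit vectors is almost annihilated by `B = E - T`
  have hkey : ∀ n, ‖B (v n)‖ ^ 2 ≤ (‖B‖ + 1) * (E - r n) := by
    intro n
    have h := norm_sq_le_of_nonneg_form hBsym (V := V)
      (fun u hu => V.sub_mem (V.smul_mem _ hu) (hTV u hu))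
      (fun u hu => by rw [hBform]; linarith [hle u hu])
      (M := ‖B‖ + 1) (by positivity) (by linarith) (hvV n)
    rw [hBform, hv1, hvr] at h
    simpa using h
  have hlim0 : Tendsto (fun n => B (v n)) atTop (𝓝 0) := by
    rw [tendsto_zero_iff_norm_tendsto_zero]
    have h1 : Tendsto (fun n => (‖B‖ + 1) * (E - r n)) atTop (𝓝 0) := by
      have := ((tendsto_const_nhds (x := E)).sub hr).const_mul (‖B‖ + 1)
      rwa [← hE, sub_self, mul_zero] at this
    have h2 : Tendsto (fun n => ‖B (v n)‖ ^ 2) atTop (𝓝 0) :=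
      squeeze_zero (fun n => by positivity) hkey h1
    have h3 := h2.sqrt
    simpa [Real.sqrt_sq] using h3
  have hcpt := hc.isCompact_closure_image_closedBall 1
  obtain ⟨w, -, φ, hφ, hw⟩ := hcpt.tendsto_subseq (x := fun n => T (v n)) fun n =>
    subset_closure ⟨v n, by simp [hv1], rfl⟩
  have hEc : (E : ℂ) ≠ 0 := by exact_mod_cast hEpos.ne'
  have hvlim : Tendsto (fun n => v (φ n)) atTop (𝓝 ((E : ℂ)⁻¹ • w)) := by
    have h := ((hlim0.comp hφ.tendsto_atTop).add hw).const_smul (E : ℂ)⁻¹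
    rw [zero_add] at h
    refine h.congr fun n => ?_
    simp only [Function.comp_apply, hBapp, sub_add_cancel]
    rw [smul_smul, inv_mul_cancel₀ hEc, one_smul]
  set u := (E : ℂ)⁻¹ • w with hu
  have hu1 : ‖u‖ = 1 := by
    refine tendsto_nhds_unique hvlim.norm ?_
    simp [hv1]
  refine ⟨u, hV.mem_of_tendsto hvlim (Eventually.of_forall fun n => hvV _), ?_, ?_⟩
  · intro h; rw [h, norm_zero] at hu1; exact zero_ne_one hu1
  · have h := tendsto_nhds_unique ((T.continuous.tendsto u).comp hvlim) hw
    rw [h, hu, smul_smul, mul_inv_cancel₀ hEc, one_smul]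

/-- A Hilbert–Schmidt operator is compact, being the norm limit of its truncations to finitely many
basis vectors. -/
theorem isCompactOperator_of_summable {ι : Type*} {H' : Type*} [NormedAddCommGroup H']
    [InnerProductSpace ℂ H'] [CompleteSpace H'] (b : HilbertBasis ι ℂ H) (T : H →L[ℂ] H')
    (hs : Summable fun i => ‖T (b i)‖ ^ 2) : IsCompactOperator T := by
  classical
  let F : Finset ι → H →L[ℂ] H' := fun s =>
    ∑ i ∈ s, (innerSL ℂ (b i)).smulRight (T (b i))
  have hFapp : ∀ s f, F s f = ∑ i ∈ s, (inner ℂ (b i) f : ℂ) • T (b i) := by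
    intro s f; simp [F]
  have hFc : ∀ s, IsCompactOperator (F s) := by
    intro s
    have : F s ∈ compactOperator (RingHom.id ℂ) H H' := by
      refine Submodule.sum_mem _ fun i _ => ?_
      change IsCompactOperator _
      have h1 : IsCompactOperator (innerSL ℂ (b i)) :=
        isCompactOperator_of_locallyCompactSpace_dom _
      have h2 := h1.clm_comp ((ContinuousLinearMap.id ℂ ℂ).smulRight (T (b i)))
      exact h2
    exact this
  have hHas : ∀ f, HasSum (fun i => (inner ℂ (b i) f : ℂ) • T (b i)) (T f) := by
    intro f
    have h := (b.hasSum_repr f).mapL T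
    simpa [b.repr_apply_apply] using h
  refine isCompactOperator_of_tendsto (l := atTop) (F := F) ?_ (Eventually.of_forall hFc)
  rw [Metric.tendsto_atTop]
  intro ε hε
  obtain ⟨s, hsε⟩ := (summable_iff_vanishing_norm.1 hs) ((ε / 2) ^ 2) (by positivity)
  refine ⟨s, fun t ht => ?_⟩
  rw [dist_comm, dist_eq_norm]
  refine lt_of_le_of_lt (ContinuousLinearMap.opNorm_le_bound _ (by positivity) fun f => ?_)
    (half_lt_self hε)
  have hlim : Tendsto (fun t' => ‖∑ i ∈ t', (inner ℂ (b i) f : ℂ) • T (b i) - F t f‖) atTop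
      (𝓝 ‖(T - F t) f‖) := ((hHas f).sub_const _).norm
  refine le_of_tendsto hlim ?_
  filter_upwards [eventually_ge_atTop t] with t' ht'
  rw [hFapp, ← Finset.sum_sdiff ht', add_sub_cancel_right]
  have hb : ∑ i ∈ t' \ t, ‖(inner ℂ (b i) f : ℂ)‖ ^ 2 ≤ ‖f‖ ^ 2 :=
    b.orthonormal.sum_inner_products_le f
  have hd : ∑ i ∈ t' \ t, ‖T (b i)‖ ^ 2 ≤ (ε / 2) ^ 2 := by
    refine le_trans (le_abs_self _) (hsε (t' \ t) ?_).le
    exact (Finset.sdiff_disjoint).mono_right ht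
  calc ‖∑ i ∈ t' \ t, (inner ℂ (b i) f : ℂ) • T (b i)‖
      ≤ ∑ i ∈ t' \ t, ‖(inner ℂ (b i) f : ℂ)‖ * ‖T (b i)‖ := by
        refine (norm_sum_le _ _).trans (le_of_eq ?_)
        simp_rw [norm_smul]
    _ ≤ √(∑ i ∈ t' \ t, ‖(inner ℂ (b i) f : ℂ)‖ ^ 2) * √(∑ i ∈ t' \ t, ‖T (b i)‖ ^ 2) :=
        Real.sum_mul_le_sqrt_mul_sqrt _ _ _
    _ ≤ √(‖f‖ ^ 2) * √((ε / 2) ^ 2) := by gcongr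
    _ = ε / 2 * ‖f‖ := by
        rw [Real.sqrt_sq (norm_nonneg _), Real.sqrt_sq (by positivity), mul_comm]

end Abstract

/-! ### The operator is symmetric and compact -/

theorem norm_sq_eq_integral (f : L2) : ‖f‖ ^ 2 = ∫ x, ‖f x‖ ^ 2 := by
  have h : (inner ℂ f f : ℂ) = ((∫ x, ‖f x‖ ^ 2 : ℝ) : ℂ) := by
    rw [L2.inner_def, ← integral_complex_ofReal]
    refine integral_congr_ae (Eventually.of_forall fun x => ?_)
    simp [inner_self_eq_norm_sq_to_K]
  rw [inner_self_eq_norm_sq_to_K] at h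
  refine Complex.ofReal_injective (Eq.trans ?_ h)
  norm_cast

theorem kernelIntegral_congr {a : ℝ} {f g : ℝ → ℂ} (h : f =ᵐ[volume] g) (x : ℝ) :
    kernelIntegral a f x = kernelIntegral a g x := by
  refine integral_congr_ae ?_
  filter_upwards [h] with y hy
  rw [hy]

theorem inner_operator (a : ℝ) (f g : L2) :
    inner ℂ f (operator a g) = ∫ x, kernelIntegral a g x * (starRingEnd ℂ) (f x) := by
  rw [L2.inner_def]
  refine integral_congr_ae ?_
  filter_upwards [operator_ae_eq a g] with x hx
  rw [hx]
  rfl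

/-- The modulus of a square-integrable function, as an element of `L²(ℝ)`. -/
def absL2 (f : L2) : L2 := ((Lp.memLp f).norm.ofReal (K := ℂ)).toLp _

theorem absL2_ae_eq (f : L2) : absL2 f =ᵐ[volume] fun x => ((‖f x‖ : ℝ) : ℂ) :=
  MemLp.coeFn_toLp _

theorem norm_absL2 (f : L2) : ‖absL2 f‖ = ‖f‖ := by
  rw [Lp.norm_def, Lp.norm_def]
  congr 1
  refine eLpNorm_congr_norm_ae ?_
  filter_upwards [absL2_ae_eq f] with x hx
  simp [hx]

theorem kernelIntegral_absL2 (a : ℝ) (f : L2) (x : ℝ) :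
    kernelIntegral a (absL2 f) x = ((∫ y, kernel a x y * ‖f y‖ : ℝ) : ℂ) := by
  rw [kernelIntegral_congr (absL2_ae_eq f), kernelIntegral, ← integral_complex_ofReal]
  simp

theorem norm_kernel_mul (a x y : ℝ) (z : ℂ) : ‖(kernel a x y : ℂ) * z‖ = kernel a x y * ‖z‖ := by
  rw [norm_mul, Complex.norm_real, Real.norm_of_nonneg (kernel_nonneg a x y)]

theorem integrable_kernel_mul_norm (a x : ℝ) (f : L2) :
    Integrable fun y => kernel a x y * ‖f y‖ := by
  simpa only [norm_kernel_mul] using (integrable_kernel_mul a x f).norm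

theorem norm_kernelIntegral_le (a : ℝ) (f : L2) (x : ℝ) :
    ‖kernelIntegral a f x‖ ≤ ∫ y, kernel a x y * ‖f y‖ := by
  refine (norm_integral_le_integral_norm _).trans (le_of_eq ?_)
  simp only [norm_kernel_mul]

theorem integrable_kernelIntegral_mul (a : ℝ) (f g : L2) :
    Integrable fun x => kernelIntegral a g x * (starRingEnd ℂ) (f x) := by
  refine (memLp_kernelIntegral a g).integrable_mul (q := 2) ?_
  exact (Lp.memLp f).star

theorem integrable_norm_mul_kernel (a : ℝ) (f g : L2) :
    Integrable fun x => (∫ y, kernel a x y * ‖g y‖) * ‖f x‖ := by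
  have h := (integrable_kernelIntegral_mul a f (absL2 g)).norm
  refine h.congr (Eventually.of_forall fun x => ?_)
  simp only [norm_mul, kernelIntegral_absL2, Complex.norm_real, RCLike.norm_conj]
  rw [Real.norm_of_nonneg]
  exact integral_nonneg fun y => mul_nonneg (kernel_nonneg a x y) (norm_nonneg _)

/-- The integrability behind Fubini's theorem for the sesquilinear form of `K_a`. -/
theorem integrable_kernel_prod (a : ℝ) (f g : L2) :
    Integrable (fun p : ℝ × ℝ => (kernel a p.1 p.2 : ℂ) * g p.2 * (starRingEnd ℂ) (f p.1))
      (volume.prod volume) := by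
  have hm : AEStronglyMeasurable
      (fun p : ℝ × ℝ => (kernel a p.1 p.2 : ℂ) * g p.2 * (starRingEnd ℂ) (f p.1))
      (volume.prod volume) := by
    refine StronglyMeasurable.aestronglyMeasurable ?_
    refine ((Complex.continuous_ofReal.comp (kernel_continuous a)).stronglyMeasurable.mul
      ((Lp.stronglyMeasurable g).comp_measurable measurable_snd)).mul ?_
    exact Complex.continuous_conj.comp_stronglyMeasurable
      ((Lp.stronglyMeasurable f).comp_measurable measurable_fst)
  rw [integrable_prod_iff hm]
  constructor
  · exact Eventually.of_forall fun x => (integrable_kernel_mul a x g).mul_const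
      ((starRingEnd ℂ) (f x))
  · refine (integrable_norm_mul_kernel a f g).congr (Eventually.of_forall fun x => ?_)
    simp only [norm_mul _ ((starRingEnd ℂ) _), norm_kernel_mul, RCLike.norm_conj]
    rw [integral_mul_const]

theorem operator_isSymmetric (a : ℝ) : (operator a).toLinearMap.IsSymmetric := by
  intro f g
  change inner ℂ (operator a f) g = inner ℂ f (operator a g)
  rw [← inner_conj_symm, inner_operator, inner_operator, ← integral_conj]
  have h1 : ∀ x, (starRingEnd ℂ) (kernelIntegral a f x * (starRingEnd ℂ) (g x)) =
      ∫ y, (kernel a y x : ℂ) * g x * (starRingEnd ℂ) (f y) := by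
    intro x
    rw [map_mul, Complex.conj_conj, kernelIntegral, ← integral_conj, ← integral_mul_const]
    refine integral_congr_ae (Eventually.of_forall fun y => ?_)
    simp only [map_mul, Complex.conj_ofReal, kernel_symm a x y]
    ring
  have h2 : ∀ x, kernelIntegral a g x * (starRingEnd ℂ) (f x) =
      ∫ y, (kernel a x y : ℂ) * g y * (starRingEnd ℂ) (f x) := by
    intro x
    rw [kernelIntegral, integral_mul_const]
  simp_rw [h1, h2]
  exact (integral_integral_swap (integrable_kernel_prod a f g)).symm

theorem integrable_one_div_one_add_quartic {a : ℝ} (ha : 0 < a) :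
    Integrable fun x : ℝ => 1 / (1 + a ^ 2 * x ^ 4) := by
  refine ((integrable_inv_one_add_sq).const_mul (1 + 1 / a ^ 2)).mono
    (Continuous.aestronglyMeasurable ?_) (Eventually.of_forall fun x => ?_)
  · exact continuous_const.div (by fun_prop) fun x => by positivity
  · rw [Real.norm_of_nonneg (by positivity), Real.norm_of_nonneg (by positivity),
      ← div_eq_mul_inv, div_le_div_iff₀ (by positivity) (by positivity)]
    have : (1 + 1 / a ^ 2) * (1 + a ^ 2 * x ^ 4) =
        1 + a ^ 2 * x ^ 4 + 1 / a ^ 2 + x ^ 4 := by field_simp; ring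
    rw [this]
    have h3 : 0 < 1 / a ^ 2 := by positivity
    nlinarith [sq_nonneg (x ^ 2 - 1), sq_nonneg (a * x ^ 2), sq_nonneg (x^2)]

theorem integrable_kernel (a x : ℝ) : Integrable fun y => kernel a x y := by
  have hc : Continuous fun y => kernel a x y :=
    (kernel_continuous a).comp (Continuous.prodMk_right x)
  refine ⟨hc.aestronglyMeasurable, lt_of_le_of_lt ?_ ENNReal.one_lt_top⟩
  refine le_trans (le_of_eq (lintegral_congr fun y => ?_)) (lintegral_kernel_le a x)
  rw [← ofReal_norm, Real.norm_of_nonneg (kernel_nonneg a x y)]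

theorem integral_kernel_le (a x : ℝ) : ∫ y, kernel a x y ≤ 1 := by
  rw [integral_eq_lintegral_of_nonneg_ae (Eventually.of_forall (kernel_nonneg a x))
    (integrable_kernel a x).1]
  exact ENNReal.toReal_le_of_le_ofReal zero_le_one (by simpa using lintegral_kernel_le a x)

theorem kernel_pos (a x y : ℝ) : 0 < kernel a x y := by
  have := Real.pi_pos
  unfold kernel
  positivity

theorem kernel_le_quartic (a x y : ℝ) : kernel a x y ≤ 1 / (1 + a ^ 2 * x ^ 4) := by
  have h1 : 1 / Real.pi ≤ 1 := by
    rw [div_le_one Real.pi_pos]; linarith [Real.pi_gt_three]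
  have h2 : 1 / (1 + (x - y) ^ 2 + a ^ 2 * (x ^ 2 + y ^ 2) ^ 2) ≤ 1 / (1 + a ^ 2 * x ^ 4) := by
    apply one_div_le_one_div_of_le (by positivity)
    have h3 : x ^ 4 ≤ (x ^ 2 + y ^ 2) ^ 2 := by nlinarith [sq_nonneg (x * y), sq_nonneg (y ^ 2)]
    have h4 := mul_le_mul_of_nonneg_left h3 (sq_nonneg a)
    nlinarith [sq_nonneg (x - y)]
  unfold kernel
  calc _ ≤ 1 * (1 / (1 + a ^ 2 * x ^ 4)) := by gcongr
    _ = _ := one_mul _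

/-- The section `y ↦ K_a(x, y)` as an element of `L²(ℝ)`. -/
def kernelSection (a x : ℝ) : L2 := (memLp_kernel a x).toLp _

theorem kernelIntegral_eq_inner (a x : ℝ) (f : L2) :
    kernelIntegral a f x = inner ℂ (kernelSection a x) f := by
  rw [L2.inner_def]
  refine integral_congr_ae ?_
  filter_upwards [MemLp.coeFn_toLp (memLp_kernel a x)] with y hy
  rw [kernelSection, hy, RCLike.inner_apply, Complex.conj_ofReal, mul_comm]

theorem norm_kernelSection_sq_le (a x : ℝ) :
    ‖kernelSection a x‖ ^ 2 ≤ 1 / (1 + a ^ 2 * x ^ 4) := by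
  rw [norm_sq_eq_integral]
  calc ∫ y, ‖kernelSection a x y‖ ^ 2 = ∫ y, kernel a x y ^ 2 := by
        refine integral_congr_ae ?_
        filter_upwards [MemLp.coeFn_toLp (memLp_kernel a x)] with y hy
        rw [kernelSection, hy, Complex.norm_real, Real.norm_eq_abs, sq_abs]
    _ ≤ ∫ y, 1 / (1 + a ^ 2 * x ^ 4) * kernel a x y := by
        refine integral_mono_of_nonneg (Eventually.of_forall fun y => sq_nonneg _)
          ((integrable_kernel a x).const_mul _) (Eventually.of_forall fun y => ?_)
        dsimp only
        rw [sq]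
        exact mul_le_mul_of_nonneg_right (kernel_le_quartic a x y) (kernel_nonneg a x y)
    _ ≤ _ := by
        rw [integral_const_mul]
        exact mul_le_of_le_one_right (by positivity) (integral_kernel_le a x)

/-- By Bessel's inequality for the sections `K_a(x, ·)`, the Hilbert–Schmidt sums are bounded by
`∫ ‖K_a(x, ·)‖² dx`. -/
theorem operator_isCompactOperator {a : ℝ} (ha : 0 < a) : IsCompactOperator (operator a) := by
  obtain ⟨w, b, -⟩ := exists_hilbertBasis ℂ L2
  refine isCompactOperator_of_summable b _ ?_
  refine summable_of_sum_le (c := ∫ x, 1 / (1 + a ^ 2 * x ^ 4)) (fun _ => sq_nonneg _) fun s => ?_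
  have hint : ∀ f : L2, Integrable fun x => ‖kernelIntegral a f x‖ ^ 2 := fun f =>
    (memLp_two_iff_integrable_sq_norm (memLp_kernelIntegral a f).1).1 (memLp_kernelIntegral a f)
  calc ∑ i ∈ s, ‖operator a (b i)‖ ^ 2 = ∑ i ∈ s, ∫ x, ‖kernelIntegral a (b i) x‖ ^ 2 := by
        refine Finset.sum_congr rfl fun i _ => ?_
        rw [norm_sq_eq_integral]
        refine integral_congr_ae ?_
        filter_upwards [operator_ae_eq a (b i)] with x hx
        rw [hx]; rfl
    _ = ∫ x, ∑ i ∈ s, ‖kernelIntegral a (b i) x‖ ^ 2 :=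
        (integral_finsetSum _ fun i _ => hint _).symm
    _ ≤ _ := by
        refine integral_mono (integrable_finsetSum _ fun i _ => hint _)
          (integrable_one_div_one_add_quartic ha) fun x => ?_
        refine le_trans ?_ (norm_kernelSection_sq_le a x)
        refine le_trans (le_of_eq ?_) (b.orthonormal.sum_inner_products_le (s := s) _)
        refine Finset.sum_congr rfl fun i _ => ?_
        rw [kernelIntegral_eq_inner, norm_inner_symm]

/-! ### Parity and comparison with the modulus -/

/-- The reflection `f ↦ f(-·)`, a linear isometry of `L²(ℝ)`. -/
def reflection : L2 →ₗᵢ[ℂ] L2 :=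
  Lp.compMeasurePreservingₗᵢ ℂ (fun x : ℝ => -x) (Measure.measurePreserving_neg volume)

theorem reflection_ae_eq (f : L2) : reflection f =ᵐ[volume] fun x => f (-x) :=
  Lp.coeFn_compMeasurePreserving f (Measure.measurePreserving_neg volume)

theorem mem_paritySubspace_iff {ε : ℂ} {f : L2} :
    f ∈ paritySubspace ε ↔ reflection f = ε • f := by
  change (∀ᵐ x : ℝ, f (-x) = ε * f x) ↔ _
  rw [Lp.ext_iff]
  constructor <;> intro h
  · filter_upwards [h, reflection_ae_eq f, Lp.coeFn_smul ε f] with x h1 h2 h3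
    rw [h2, h3, h1, Pi.smul_apply, smul_eq_mul]
  · filter_upwards [h, reflection_ae_eq f, Lp.coeFn_smul ε f] with x h1 h2 h3
    rw [← h2, h1, h3, Pi.smul_apply, smul_eq_mul]

theorem isClosed_paritySubspace (ε : ℂ) : IsClosed (paritySubspace ε : Set L2) := by
  have : (paritySubspace ε : Set L2) = {f | reflection f = ε • f} :=
    Set.ext fun f => mem_paritySubspace_iff
  rw [this]
  exact isClosed_eq reflection.continuous (continuous_const_smul ε)

theorem reflection_reflection (f : L2) : reflection (reflection f) = f := by
  rw [Lp.ext_iff]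
  filter_upwards [reflection_ae_eq (reflection f), ae_neg (reflection_ae_eq f)] with x h1 h2
  rw [h1, h2, neg_neg]

theorem exists_even_add_odd (f : L2) :
    ∃ u ∈ evenSubspace, ∃ v ∈ oddSubspace, f = u + v := by
  refine ⟨(1 / 2 : ℂ) • (f + reflection f), ?_, (1 / 2 : ℂ) • (f - reflection f), ?_, ?_⟩
  · refine mem_paritySubspace_iff.2 ?_
    rw [map_smul, map_add, reflection_reflection, one_smul, add_comm]
  · refine mem_paritySubspace_iff.2 ?_
    rw [map_smul, map_sub, reflection_reflection, ← smul_comm, neg_one_smul, neg_sub]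
  · module

theorem inner_even_odd {u v : L2} (hu : u ∈ evenSubspace) (hv : v ∈ oddSubspace) :
    inner ℂ u v = (0 : ℂ) := by
  have h := reflection.inner_map_map u v
  rw [mem_paritySubspace_iff.1 hu, mem_paritySubspace_iff.1 hv, one_smul, neg_one_smul,
    inner_neg_right] at h
  exact self_eq_neg.1 h.symm

theorem absL2_mem_evenSubspace {f : L2} (hf : f ∈ oddSubspace) : absL2 f ∈ evenSubspace := by
  change ∀ᵐ x : ℝ, absL2 f (-x) = 1 * absL2 f x
  have hf' : ∀ᵐ x : ℝ, f (-x) = -1 * f x := hf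
  filter_upwards [hf', absL2_ae_eq f, ae_neg (absL2_ae_eq f)] with x h1 h2 h3
  rw [h2, h3, h1]
  simp

theorem re_inner_operator_absL2 (a : ℝ) (f : L2) :
    (inner ℂ (operator a (absL2 f)) (absL2 f)).re =
      ∫ x, (∫ y, kernel a x y * ‖f y‖) * ‖f x‖ := by
  have hs : inner ℂ (operator a (absL2 f)) (absL2 f) = inner ℂ (absL2 f) (operator a (absL2 f)) :=
    operator_isSymmetric a _ _
  have h : ∫ x, kernelIntegral a (absL2 f) x * (starRingEnd ℂ) (absL2 f x) =
      ((∫ x, (∫ y, kernel a x y * ‖f y‖) * ‖f x‖ : ℝ) : ℂ) := by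
    rw [← integral_complex_ofReal]
    refine integral_congr_ae ?_
    filter_upwards [absL2_ae_eq f] with x hx
    rw [hx, kernelIntegral_absL2, Complex.conj_ofReal, Complex.ofReal_mul]
  rw [hs, inner_operator, h, Complex.ofReal_re]

theorem integrable_norm_kernelIntegral_mul (a : ℝ) (f : L2) :
    Integrable fun x => ‖kernelIntegral a f x‖ * ‖f x‖ := by
  simpa only [norm_mul, RCLike.norm_conj] using (integrable_kernelIntegral_mul a f f).norm

theorem norm_inner_operator_le_integral (a : ℝ) (f : L2) :
    ‖inner ℂ (operator a f) f‖ ≤ ∫ x, ‖kernelIntegral a f x‖ * ‖f x‖ := by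
  rw [norm_inner_symm, inner_operator]
  refine (norm_integral_le_integral_norm _).trans (le_of_eq ?_)
  simp only [norm_mul, RCLike.norm_conj]

/-- Replacing `f` by `|f|` does not decrease the modulus of the form, as the kernel is
nonnegative. -/
theorem norm_inner_operator_le_abs (a : ℝ) (f : L2) :
    ‖inner ℂ (operator a f) f‖ ≤ (inner ℂ (operator a (absL2 f)) (absL2 f)).re := by
  rw [re_inner_operator_absL2]
  refine (norm_inner_operator_le_integral a f).trans ?_
  refine integral_mono (integrable_norm_kernelIntegral_mul a f) (integrable_norm_mul_kernel a f f)
    fun x => ?_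
  exact mul_le_mul_of_nonneg_right (norm_kernelIntegral_le a f x) (norm_nonneg _)

/-- For odd `f` the kernel may be replaced by `(K_a(x, y) - K_a(x, -y)) / 2`, whose modulus is
strictly below `(K_a(x, y) + K_a(x, -y)) / 2`. -/
theorem norm_kernelIntegral_lt_of_odd {a : ℝ} {f : L2} (hf : f ∈ oddSubspace) (hf0 : f ≠ 0)
    (x : ℝ) : ‖kernelIntegral a f x‖ < ∫ y, kernel a x y * ‖f y‖ := by
  have hodd : ∀ᵐ y : ℝ, f (-y) = -1 * f y := hf
  have hi := integrable_kernel_mul a x f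
  have hin := integrable_kernel_mul_norm a x f
  -- substituting `y ↦ -y` turns `f` into `-f` and leaves `‖f‖` unchanged
  have hi' : Integrable fun y => (kernel a x (-y) : ℂ) * f y := by
    refine (hi.comp_neg.neg).congr ?_
    filter_upwards [hodd] with y hy
    simp [hy]
  have hin' : Integrable fun y => kernel a x (-y) * ‖f y‖ := by
    simpa only [norm_kernel_mul] using hi'.norm
  have h1 : kernelIntegral a f x = -∫ y, (kernel a x (-y) : ℂ) * f y := by
    rw [kernelIntegral, ← integral_neg_eq_self, ← integral_neg]
    refine integral_congr_ae ?_
    filter_upwards [hodd] with y hy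
    simp [hy]
  have h2 : ∫ y, kernel a x y * ‖f y‖ = ∫ y, kernel a x (-y) * ‖f y‖ := by
    rw [← integral_neg_eq_self]
    refine integral_congr_ae ?_
    filter_upwards [hodd] with y hy
    simp [hy]
  have h3 : 2 * kernelIntegral a f x =
      ∫ y, ((kernel a x y - kernel a x (-y) : ℝ) : ℂ) * f y := by
    have : ∀ y, ((kernel a x y - kernel a x (-y) : ℝ) : ℂ) * f y =
        (kernel a x y : ℂ) * f y - (kernel a x (-y) : ℂ) * f y := by
      intro y; push_cast; ring
    simp_rw [this]
    rw [integral_sub hi hi', two_mul]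
    nth_rewrite 2 [h1]
    rw [← sub_eq_add_neg]
    rfl
  have h4 : 2 * ‖kernelIntegral a f x‖ ≤ ∫ y, |kernel a x y - kernel a x (-y)| * ‖f y‖ := by
    have := norm_integral_le_integral_norm (μ := volume)
      fun y => ((kernel a x y - kernel a x (-y) : ℝ) : ℂ) * f y
    rw [← h3, norm_mul] at this
    simpa only [norm_mul, Complex.norm_real, Real.norm_eq_abs, Complex.norm_ofNat] using this
  have hiabs : Integrable fun y => |kernel a x y - kernel a x (-y)| * ‖f y‖ := by
    refine (hin.sub hin').norm.congr (Eventually.of_forall fun y => ?_)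
    simp only [Pi.sub_apply]
    rw [← sub_mul, norm_mul, Real.norm_eq_abs, norm_norm]
  have h5 : ∫ y, |kernel a x y - kernel a x (-y)| * ‖f y‖ <
      ∫ y, (kernel a x y * ‖f y‖ + kernel a x (-y) * ‖f y‖) := by
    have habs : ∀ y, |kernel a x y - kernel a x (-y)| < kernel a x y + kernel a x (-y) := by
      intro y
      rw [abs_lt]
      constructor <;> linarith [kernel_pos a x y, kernel_pos a x (-y)]
    have hle : ∀ y, |kernel a x y - kernel a x (-y)| * ‖f y‖ ≤
        kernel a x y * ‖f y‖ + kernel a x (-y) * ‖f y‖ := by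
      intro y
      rw [← add_mul]
      exact mul_le_mul_of_nonneg_right (habs y).le (norm_nonneg _)
    refine lt_of_le_of_ne (integral_mono hiabs (hin.add hin') hle) fun heq => hf0 ?_
    rw [Lp.ext_iff]
    have hae := (integral_eq_iff_of_ae_le hiabs (hin.add hin') (Eventually.of_forall hle)).1 heq
    filter_upwards [hae, Lp.coeFn_zero ℂ 2 (volume : Measure ℝ)] with y hy h0
    rw [h0, Pi.zero_apply]
    by_contra hne
    have := mul_lt_mul_of_pos_right (habs y) (norm_pos_iff.2 hne)
    simp only [Pi.add_apply] at hy
    linarith [add_mul (kernel a x y) (kernel a x (-y)) ‖f y‖]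
  rw [integral_add hin hin', ← h2] at h5
  linarith

theorem re_inner_operator_lt_abs_of_odd {a : ℝ} {f : L2} (hf : f ∈ oddSubspace) (hf0 : f ≠ 0) :
    (inner ℂ (operator a f) f).re < (inner ℂ (operator a (absL2 f)) (absL2 f)).re := by
  rw [re_inner_operator_absL2]
  refine ((Complex.re_le_norm _).trans (norm_inner_operator_le_integral a f)).trans_lt ?_
  have hi := integrable_norm_kernelIntegral_mul a f
  have hi' := integrable_norm_mul_kernel a f f
  have hle : ∀ x, ‖kernelIntegral a f x‖ * ‖f x‖ ≤ (∫ y, kernel a x y * ‖f y‖) * ‖f x‖ := fun x =>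
    mul_le_mul_of_nonneg_right (norm_kernelIntegral_le a f x) (norm_nonneg _)
  refine lt_of_le_of_ne (integral_mono hi hi' hle) fun heq => hf0 ?_
  rw [Lp.ext_iff]
  have hae := (integral_eq_iff_of_ae_le hi hi' (Eventually.of_forall hle)).1 heq
  filter_upwards [hae, Lp.coeFn_zero ℂ 2 (volume : Measure ℝ)] with y hy h0
  rw [h0, Pi.zero_apply]
  by_contra hne
  exact (mul_lt_mul_of_pos_right (norm_kernelIntegral_lt_of_odd hf hf0 y)
    (norm_pos_iff.2 hne)).ne hy

theorem im_eq_zero_and_re_le_of_eigenvector {H : Type*} [NormedAddCommGroup H]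
    [InnerProductSpace ℂ H] {T : H →L[ℂ] H} (hT : T.toLinearMap.IsSymmetric) {E : ℝ} {μ : ℂ}
    {v : H} (hv : v ≠ 0) (hTv : T v = μ • v) (hE : (inner ℂ (T v) v).re ≤ E * ‖v‖ ^ 2) :
    μ.im = 0 ∧ μ.re ≤ E := by
  have hn : (0 : ℝ) < ‖v‖ ^ 2 := by positivity
  have hvv : (inner ℂ v v : ℂ) = ((‖v‖ ^ 2 : ℝ) : ℂ) := by
    rw [inner_self_eq_norm_sq_to_K]; norm_cast
  have hs : inner ℂ (T v) v = inner ℂ v (T v) := hT v v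
  constructor
  · rw [hTv, inner_smul_left, inner_smul_right, hvv] at hs
    have := mul_right_cancel₀ (by exact_mod_cast hn.ne') hs
    exact Complex.conj_eq_iff_im.1 this
  · rw [hs, hTv, inner_smul_right, hvv, Complex.re_mul_ofReal] at hE
    exact le_of_mul_le_mul_right hE hn

theorem isLargestEigenvalue_restrict {H : Type*} [NormedAddCommGroup H]
    [InnerProductSpace ℂ H] {T : H →L[ℂ] H} (hT : T.toLinearMap.IsSymmetric) {V : Submodule ℂ H}
    (hV : ∀ v ∈ V, T v ∈ V) {E : ℝ} (hex : ∃ v ∈ V, v ≠ 0 ∧ T v = (E : ℂ) • v)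
    (hE : ∀ v ∈ V, (inner ℂ (T v) v).re ≤ E * ‖v‖ ^ 2) :
    IsLargestEigenvalue (T.toLinearMap.restrict hV) E := by
  constructor
  · obtain ⟨v, hvV, hv0, hTv⟩ := hex
    refine Module.End.hasEigenvalue_of_hasEigenvector (x := ⟨v, hvV⟩)
      ⟨Module.End.mem_eigenspace_iff.2 (Subtype.ext hTv), fun h => hv0 ?_⟩
    exact congrArg Subtype.val h
  · intro μ hμ
    obtain ⟨⟨v, hvV⟩, hv, hv0⟩ := hμ.exists_hasEigenvector
    have hTv : T v = μ • v := congrArg Subtype.val (Module.End.mem_eigenspace_iff.1 hv)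
    exact im_eq_zero_and_re_le_of_eigenvector hT (fun h => hv0 (Subtype.ext h)) hTv (hE v hvV)

/-- The largest eigenvalues of `K_a` and of its even part coincide with each other and with the
norm, and exceed that of the odd part, which is the supremum of the Rayleigh quotient on odd
functions. -/
theorem exists_largest_eigenvalues {a : ℝ} (ha : 0 < a)
    (hpos : ∃ f ∈ oddSubspace, 0 < (inner ℂ (operator a f) f).re) :
    ∃ E Eo : ℝ, IsLargestEigenvalue (operator a).toLinearMap E ∧ E = ‖operator a‖ ∧
      IsLargestEigenvalue (evenOperator a) E ∧ IsLargestEigenvalue (oddOperator a) Eo ∧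
      Eo < E ∧ ∀ f ∈ oddSubspace, (inner ℂ (operator a f) f).re ≤ Eo * ‖f‖ ^ 2 := by
  have hsym := operator_isSymmetric a
  have hc := operator_isCompactOperator ha
  obtain ⟨Eo, hEo, ⟨g, hgV, hg0, hg⟩, hEo_le⟩ := exists_top_eigenvector hsym hc
    (isClosed_paritySubspace (-1)) (operator_mem_paritySubspace a (-1)) hpos
  have hgform : (inner ℂ (operator a g) g).re = Eo * ‖g‖ ^ 2 := by
    rw [hg, inner_smul_left, inner_self_eq_norm_sq_to_K, Complex.conj_ofReal,
      Complex.re_ofReal_mul]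
    norm_cast
  have hlt := re_inner_operator_lt_abs_of_odd (a := a) hgV hg0
  have hgn : 0 < ‖g‖ ^ 2 := by positivity
  rw [hgform] at hlt
  obtain ⟨E, hE, ⟨u, huV, hu0, hu⟩, hE_le⟩ := exists_top_eigenvector hsym hc
    (isClosed_paritySubspace 1) (operator_mem_paritySubspace a 1)
    ⟨absL2 g, absL2_mem_evenSubspace hgV, lt_trans (by positivity) hlt⟩
  have hlt' : Eo < E := by
    have h := hlt.trans_le (hE_le _ (absL2_mem_evenSubspace hgV))
    rw [norm_absL2] at h
    exact lt_of_mul_lt_mul_right h hgn.le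
  have hall : ∀ f : L2, (inner ℂ (operator a f) f).re ≤ E * ‖f‖ ^ 2 := by
    intro f
    obtain ⟨p, hp, q, hq, rfl⟩ := exists_even_add_odd f
    have hKp : operator a p ∈ evenSubspace := operator_mem_paritySubspace a 1 p hp
    have hKq : operator a q ∈ oddSubspace := operator_mem_paritySubspace a (-1) q hq
    have h1 : inner ℂ (operator a q) p = (0 : ℂ) := by
      rw [← inner_conj_symm, inner_even_odd hp hKq, map_zero]
    have h2 := norm_add_sq_eq_norm_sq_add_norm_sq_of_inner_eq_zero p q (inner_even_odd hp hq)
    rw [map_add, inner_add_left, inner_add_right, inner_add_right, inner_even_odd hKp hq, h1,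
      add_zero, zero_add, Complex.add_re]
    have h3 : E * ‖p + q‖ ^ 2 = E * ‖p‖ ^ 2 + E * ‖q‖ ^ 2 := by
      rw [sq, h2]; ring
    have h4 : Eo * ‖q‖ ^ 2 ≤ E * ‖q‖ ^ 2 := by gcongr
    linarith [hE_le p hp, hEo_le q hq]
  refine ⟨E, Eo, ⟨?_, ?_⟩, ?_, ?_, ?_, hlt', hEo_le⟩
  · exact Module.End.hasEigenvalue_of_hasEigenvector
      (x := u) ⟨Module.End.mem_eigenspace_iff.2 hu, hu0⟩
  · intro μ hμ
    obtain ⟨v, hv, hv0⟩ := hμ.exists_hasEigenvector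
    exact im_eq_zero_and_re_le_of_eigenvector hsym hv0 (Module.End.mem_eigenspace_iff.1 hv) (hall v)
  · apply le_antisymm
    · have h := (operator a).le_opNorm u
      rw [hu, norm_smul, Complex.norm_real, Real.norm_of_nonneg hE.le] at h
      exact le_of_mul_le_mul_right h (norm_pos_iff.2 hu0)
    · rw [ContinuousLinearMap.norm_eq_iSup_rayleighQuotient _ hsym]
      refine ciSup_le fun f => ?_
      rw [ContinuousLinearMap.rayleighQuotient, abs_div, abs_of_nonneg (sq_nonneg ‖f‖)]
      refine div_le_of_le_mul₀ (sq_nonneg _) hE.le ?_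
      calc |(operator a).reApplyInnerSelf f| ≤ ‖inner ℂ (operator a f) f‖ :=
            Complex.abs_re_le_norm _
        _ ≤ _ := norm_inner_operator_le_abs a f
        _ ≤ E * ‖absL2 f‖ ^ 2 := hall _
        _ = _ := by rw [norm_absL2]
  · exact isLargestEigenvalue_restrict hsym _ ⟨u, huV, hu0, hu⟩ hE_le
  · exact isLargestEigenvalue_restrict hsym _ ⟨g, hgV, hg0, hg⟩ hEo_le

/-! ### Upper bound for the eigenvalues -/

/-- A Collatz–Wielandt bound: a positive square-integrable supersolution `K_a h ≤ c h` bounds every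
eigenvalue by `c`, as one sees by pairing `|ψ|` with `h`. -/
theorem eigenvalue_le_of_integral_kernel_mul_le {a c E : ℝ} {h : ℝ → ℝ} (hpos : ∀ x, 0 < h x)
    (hmem : MemLp (fun x => (h x : ℂ)) 2 volume) (hc : ∀ x, ∫ y, kernel a x y * h y ≤ c * h x)
    {ψ : L2} (hψ0 : ψ ≠ 0) (hψ : operator a ψ = (E : ℂ) • ψ) : E ≤ c := by
  set η : L2 := hmem.toLp _ with hη
  have hηae : η =ᵐ[volume] fun x => (h x : ℂ) := MemLp.coeFn_toLp hmem
  have hKη : ∀ x, kernelIntegral a η x = ((∫ y, kernel a x y * h y : ℝ) : ℂ) := by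
    intro x
    rw [kernelIntegral_congr hηae, kernelIntegral, ← integral_complex_ofReal]
    simp
  have hJ : Integrable fun x => h x * ‖ψ x‖ := by
    refine ((hmem.norm.integrable_mul (Lp.memLp ψ).norm)).congr (Eventually.of_forall fun x => ?_)
    simp [Complex.norm_real, abs_of_pos (hpos x)]
  have hJpos : 0 < ∫ x, h x * ‖ψ x‖ := by
    have hnn : ∀ x, 0 ≤ h x * ‖ψ x‖ := fun x => mul_nonneg (hpos x).le (norm_nonneg _)
    refine lt_of_le_of_ne (integral_nonneg hnn) fun h0 => hψ0 ?_
    have hae := (integral_eq_zero_iff_of_nonneg hnn hJ).1 h0.symm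
    rw [Lp.ext_iff]
    filter_upwards [hae, Lp.coeFn_zero ℂ 2 (volume : Measure ℝ)] with y hy h0
    rw [h0]
    simpa [(hpos y).ne'] using hy
  have hI1 : Integrable fun x => (∫ y, kernel a x y * h y) * ‖ψ x‖ := by
    refine (integrable_kernelIntegral_mul a ψ η).norm.congr (Eventually.of_forall fun x => ?_)
    simp only [norm_mul, hKη, Complex.norm_real, RCLike.norm_conj]
    rw [Real.norm_of_nonneg]
    exact integral_nonneg fun y => mul_nonneg (kernel_nonneg a x y) (hpos y).le
  have hI2 : Integrable fun x => (∫ y, kernel a x y * ‖ψ y‖) * h x := by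
    refine (integrable_norm_mul_kernel a η ψ).congr ?_
    filter_upwards [hηae] with x hx
    rw [hx, Complex.norm_real, Real.norm_of_nonneg (hpos x).le]
  have hsym : ∫ x, (∫ y, kernel a x y * h y) * ‖ψ x‖ = ∫ x, (∫ y, kernel a x y * ‖ψ y‖) * h x := by
    have h1 : inner ℂ (absL2 ψ) (operator a η) =
        ((∫ x, (∫ y, kernel a x y * h y) * ‖ψ x‖ : ℝ) : ℂ) := by
      rw [inner_operator, ← integral_complex_ofReal]
      refine integral_congr_ae ?_
      filter_upwards [absL2_ae_eq ψ] with x hx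
      rw [hx, hKη, Complex.conj_ofReal, Complex.ofReal_mul]
    have h2 : inner ℂ η (operator a (absL2 ψ)) =
        ((∫ x, (∫ y, kernel a x y * ‖ψ y‖) * h x : ℝ) : ℂ) := by
      rw [inner_operator, ← integral_complex_ofReal]
      refine integral_congr_ae ?_
      filter_upwards [hηae] with x hx
      rw [hx, kernelIntegral_absL2, Complex.conj_ofReal, Complex.ofReal_mul]
    have h3 : inner ℂ (operator a (absL2 ψ)) η = inner ℂ (absL2 ψ) (operator a η) :=
      operator_isSymmetric a _ _
    rw [h1, ← inner_conj_symm, h2, Complex.conj_ofReal] at h3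
    exact_mod_cast h3.symm
  have hle : E * ∫ x, h x * ‖ψ x‖ ≤ c * ∫ x, h x * ‖ψ x‖ := by
    calc E * ∫ x, h x * ‖ψ x‖ = ∫ x, E * (h x * ‖ψ x‖) := (integral_const_mul _ _).symm
      _ ≤ ∫ x, (∫ y, kernel a x y * ‖ψ y‖) * h x := by
          refine integral_mono_ae (hJ.const_mul _) hI2 ?_
          filter_upwards [operator_ae_eq a ψ, Lp.coeFn_smul (E : ℂ) ψ] with x h1 h2
          rw [hψ, h2, Pi.smul_apply, smul_eq_mul] at h1
          have h4 : ‖(E : ℂ) * ψ x‖ ≤ ∫ y, kernel a x y * ‖ψ y‖ := by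
            rw [h1]; exact norm_kernelIntegral_le a ψ x
          rw [norm_mul, Complex.norm_real, Real.norm_eq_abs] at h4
          have h5 : E * ‖ψ x‖ ≤ |E| * ‖ψ x‖ := by gcongr; exact le_abs_self E
          nlinarith [hpos x, mul_le_mul_of_nonneg_right (h5.trans h4) (hpos x).le]
      _ = ∫ x, (∫ y, kernel a x y * h y) * ‖ψ x‖ := hsym.symm
      _ ≤ ∫ x, c * (h x * ‖ψ x‖) := by
          refine integral_mono hI1 (hJ.const_mul _) fun x => ?_
          dsimp only
          rw [← mul_assoc]
          exact mul_le_mul_of_nonneg_right (hc x) (norm_nonneg _)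
      _ = c * ∫ x, h x * ‖ψ x‖ := integral_const_mul _ _
  exact le_of_mul_le_mul_right hle hJpos

/-- The Poisson (Cauchy) kernel `P(u) = 1 / (π (1 + u²))`. -/
def poisson (u : ℝ) : ℝ := 1 / Real.pi * (1 / (1 + u ^ 2))

theorem poisson_nonneg (u : ℝ) : 0 ≤ poisson u := by
  have := Real.pi_pos
  unfold poisson
  positivity

theorem kernel_le_poisson (a x y : ℝ) : kernel a x y ≤ poisson (x - y) := by
  have := Real.pi_pos
  unfold kernel poisson
  gcongr 1 / Real.pi * (1 / ?_)
  exact le_add_of_nonneg_right (by positivity)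

theorem integrable_poisson : Integrable poisson := by
  refine (integrable_inv_one_add_sq.const_mul (1 / Real.pi)).congr
    (Eventually.of_forall fun u => ?_)
  simp [poisson]

theorem integral_poisson : ∫ u, poisson u = 1 := by
  have : poisson = fun u => 1 / Real.pi * (1 + u ^ 2)⁻¹ := by
    funext u; simp [poisson]
  rw [this, integral_const_mul, integral_univ_inv_one_add_sq]
  field_simp

theorem continuous_inv_sq_add_sq {β : ℝ} (hβ : 0 < β) :
    Continuous fun y : ℝ => 1 / (y ^ 2 + β ^ 2) :=
  continuous_const.div (by fun_prop) fun x => by positivity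

theorem inv_sq_add_sq_le {β : ℝ} (hβ : 1 ≤ β) (y : ℝ) : 1 / (y ^ 2 + β ^ 2) ≤ 1 := by
  rw [div_le_one (by positivity)]
  nlinarith [sq_nonneg y]

theorem integrable_poisson_mul_inv {β : ℝ} (hβ : 1 ≤ β) (x : ℝ) :
    Integrable fun y => poisson (x - y) * (1 / (y ^ 2 + β ^ 2)) := by
  refine ((integrable_poisson.comp_sub_left x).mul_bdd (c := 1)
    (continuous_inv_sq_add_sq (by linarith)).aestronglyMeasurable
    (Eventually.of_forall fun y => ?_))
  rw [Real.norm_of_nonneg (by positivity)]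
  exact inv_sq_add_sq_le hβ y

/-- Stated for a general filter so as to cover `atTop` and `atBot` at once. -/
theorem tendsto_log_sub_log {β : ℝ} (hβ : 1 ≤ β) (x : ℝ) {l : Filter ℝ}
    (hinv : Tendsto (fun y : ℝ => y⁻¹) l (𝓝 0)) (hne : ∀ᶠ y in l, y ≠ 0) :
    Tendsto (fun y => Real.log (1 + (y - x) ^ 2) - Real.log (y ^ 2 + β ^ 2)) l (𝓝 0) := by
  have h1 : Tendsto (fun y : ℝ => 1 / (y ^ 2 + β ^ 2)) l (𝓝 0) := by
    refine squeeze_zero_norm' ?_ (by simpa using hinv.norm)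
    filter_upwards [hne] with y hy
    rw [Real.norm_of_nonneg (by positivity), ← one_div]
    refine one_div_le_one_div_of_le (by positivity) ?_
    nlinarith [sq_abs y, sq_nonneg (|y| - 1)]
  have h2 : Tendsto (fun y : ℝ => y / (y ^ 2 + β ^ 2)) l (𝓝 0) := by
    refine squeeze_zero_norm' ?_ (by simpa using hinv.norm)
    filter_upwards [hne] with y hy
    have : (0 : ℝ) < y ^ 2 + β ^ 2 := by positivity
    rw [norm_div, Real.norm_of_nonneg this.le, Real.norm_eq_abs, ← one_div,
      div_le_div_iff₀ this (by positivity)]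
    nlinarith [sq_abs y]
  have h3 : Tendsto (fun y : ℝ => 1 + (1 + x ^ 2 - β ^ 2) * (1 / (y ^ 2 + β ^ 2)) -
      2 * x * (y / (y ^ 2 + β ^ 2))) l (𝓝 1) := by
    have := ((h1.const_mul (1 + x ^ 2 - β ^ 2)).const_add 1).sub (h2.const_mul (2 * x))
    simpa using this
  have h4 := ((Real.continuousAt_log one_ne_zero).tendsto.comp h3)
  rw [Real.log_one] at h4
  refine h4.congr fun y => ?_
  have hy : (0 : ℝ) < y ^ 2 + β ^ 2 := by positivity
  rw [Function.comp_apply, ← Real.log_div (by positivity) hy.ne']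
  congr 1
  field_simp
  ring

/-- The semigroup property of the Poisson kernels, `P_1 * P_β = P_(1+β)`, up to normalisation, by
partial fractions. The hypothesis `1 < β` keeps their common denominator `Δ` from vanishing. -/
theorem integral_poisson_mul_inv {β : ℝ} (hβ : 1 < β) (x : ℝ) :
    ∫ y, poisson (x - y) * (1 / (y ^ 2 + β ^ 2)) = (β + 1) / β / (x ^ 2 + (β + 1) ^ 2) := by
  have hβ0 : 0 < β := by linarith
  have hβ1 : 0 < β - 1 := by linarith
  have hpi := Real.pi_pos
  set Δ := (x ^ 2 + (β + 1) ^ 2) * (x ^ 2 + (β - 1) ^ 2) with hΔ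
  have hΔ0 : 0 < Δ := by positivity
  -- the partial fractions are `(A (y - x) + B) / (1 + (y - x)²) + (-A y + C) / (y² + β²)`
  set A := -2 * x / Δ with hA
  set B := (x ^ 2 + β ^ 2 - 1) / Δ with hB
  set C := (x ^ 2 + 1 - β ^ 2) / Δ with hC
  let F : ℝ → ℝ := fun y => 1 / Real.pi *
    (A / 2 * (Real.log (1 + (y - x) ^ 2) - Real.log (y ^ 2 + β ^ 2)) +
      B * Real.arctan (y - x) + C / β * Real.arctan (y / β))
  have hF : ∀ y, HasDerivAt F (poisson (x - y) * (1 / (y ^ 2 + β ^ 2))) y := by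
    intro y
    have hp1 : 0 < 1 + (y - x) ^ 2 := by positivity
    have hp2 : 0 < y ^ 2 + β ^ 2 := by positivity
    have d1 : HasDerivAt (fun y : ℝ => 1 + (y - x) ^ 2) (2 * (y - x)) y := by
      exact ((((hasDerivAt_id' y).sub_const x).pow 2).const_add 1).congr_deriv (by ring)
    have d2 : HasDerivAt (fun y : ℝ => y ^ 2 + β ^ 2) (2 * y) y := by
      exact (((hasDerivAt_id' y).pow 2).add_const (β ^ 2)).congr_deriv (by ring)
    have d3 := ((hasDerivAt_id' y).sub_const x).arctan
    have d4 := ((hasDerivAt_id' y).div_const β).arctan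
    have d := (((((d1.log hp1.ne').sub (d2.log hp2.ne')).const_mul (A / 2)).add
      (d3.const_mul B)).add (d4.const_mul (C / β))).const_mul (1 / Real.pi)
    refine d.congr_deriv (Eq.symm ?_)
    have hp1' : 0 < 1 + (x - y) ^ 2 := by positivity
    have key : 1 / ((1 + (y - x) ^ 2) * (y ^ 2 + β ^ 2)) =
        (A * (y - x) + B) / (1 + (y - x) ^ 2) + (-A * y + C) / (y ^ 2 + β ^ 2) := by
      rw [div_add_div _ _ hp1.ne' hp2.ne']
      congr 1
      rw [hA, hB, hC]
      field_simp
      rw [hΔ]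
      ring
    simp only [poisson]
    rw [show (x - y) ^ 2 = (y - x) ^ 2 by ring, mul_assoc]
    congr 1
    rw [one_div_mul_one_div, key]
    field_simp
    ring
  have hlim : ∀ {l : Filter ℝ} {s : ℝ}, Tendsto (fun y : ℝ => y⁻¹) l (𝓝 0) → (∀ᶠ y in l, y ≠ 0) →
      Tendsto (fun y => Real.arctan (y - x)) l (𝓝 s) →
      Tendsto (fun y => Real.arctan (y / β)) l (𝓝 s) →
      Tendsto F l (𝓝 (1 / Real.pi * (A / 2 * 0 + B * s + C / β * s))) := by
    intro l s h1 h2 h3 h4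
    exact ((((tendsto_log_sub_log hβ.le x h1 h2).const_mul _).add (h3.const_mul _)).add
      (h4.const_mul _)).const_mul _
  have htop := hlim (l := atTop) (s := Real.pi / 2) tendsto_inv_atTop_zero (eventually_ne_atTop 0)
    ((tendsto_nhds_of_tendsto_nhdsWithin Real.tendsto_arctan_atTop).comp
      (tendsto_atTop_add_const_right _ (-x) tendsto_id))
    ((tendsto_nhds_of_tendsto_nhdsWithin Real.tendsto_arctan_atTop).comp
      (tendsto_id.atTop_div_const hβ0))
  have hbot := hlim (l := atBot) (s := -(Real.pi / 2)) tendsto_inv_atBot_zero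
    (eventually_ne_atBot 0)
    ((tendsto_nhds_of_tendsto_nhdsWithin Real.tendsto_arctan_atBot).comp
      (tendsto_atBot_add_const_right _ (-x) tendsto_id))
    ((tendsto_nhds_of_tendsto_nhdsWithin Real.tendsto_arctan_atBot).comp
      (tendsto_id.atBot_div_const hβ0))
  rw [integral_of_hasDerivAt_of_tendsto hF (integrable_poisson_mul_inv hβ.le x) hbot htop]
  have : 1 / Real.pi * (A / 2 * 0 + B * (Real.pi / 2) + C / β * (Real.pi / 2)) -
      1 / Real.pi * (A / 2 * 0 + B * -(Real.pi / 2) + C / β * -(Real.pi / 2)) = B + C / β := by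
    field_simp; ring
  rw [this, hB, hC]
  field_simp
  rw [hΔ]
  ring

/-- Far out, the quartic term in the denominator of `K_a` is at least `16 r`, which lowers the kernel
by at least `2 r / π` on `|x - y| ≤ 1`. -/
theorem kernel_mul_inv_le_sub_indicator {a r x y : ℝ} (hr : 0 < r) (hr' : r ≤ 1 / 16)
    (har : a ^ 2 = r ^ 5) (hx : 4 / r ^ 2 ≤ x ^ 2) :
    kernel a x y * (1 / (y ^ 2 + (4 / r) ^ 2)) ≤
      poisson (x - y) * (1 / (y ^ 2 + (4 / r) ^ 2)) -
      (Set.Icc (x - 1) (x + 1)).indicator (fun _ => r / Real.pi * (1 / (x ^ 2 + (4 / r) ^ 2))) y := by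
  have hpi := Real.pi_pos
  have hβ : (64 : ℝ) ≤ 4 / r := by rw [le_div_iff₀ hr]; linarith
  by_cases hy : y ∈ Set.Icc (x - 1) (x + 1)
  · rw [Set.indicator_of_mem hy]
    obtain ⟨hy1, hy2⟩ := hy
    have hu : (x - y) ^ 2 ≤ 1 := by nlinarith
    have hA : 16 * r ≤ a ^ 2 * (x ^ 2 + y ^ 2) ^ 2 := by
      have h1 : (4 / r ^ 2) ^ 2 ≤ (x ^ 2 + y ^ 2) ^ 2 := by
        have : 0 ≤ 4 / r ^ 2 := by positivity
        gcongr
        nlinarith [sq_nonneg y]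
      calc 16 * r = r ^ 5 * (4 / r ^ 2) ^ 2 := by field_simp; norm_num
        _ ≤ _ := by rw [har]; gcongr
    set A := a ^ 2 * (x ^ 2 + y ^ 2) ^ 2
    have hk : kernel a x y ≤ poisson (x - y) - 2 * r / Real.pi := by
      have : 1 / (1 + (x - y) ^ 2 + A) ≤ 1 / (1 + (x - y) ^ 2) - 2 * r := by
        rw [le_sub_iff_add_le, div_add' _ _ _ (by positivity), div_le_div_iff₀ (by positivity)
          (by positivity)]
        set u := (x - y) ^ 2 with hu'
        have hu0 : 0 ≤ u := sq_nonneg _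
        have h1 : (1 + u) * (1 + u + A) ≤ 2 * (2 + A) := by
          apply mul_le_mul <;> linarith
        have h2 := mul_le_mul_of_nonneg_left h1 (show 0 ≤ 2 * r by linarith)
        nlinarith
      calc kernel a x y = 1 / Real.pi * (1 / (1 + (x - y) ^ 2 + A)) := rfl
        _ ≤ 1 / Real.pi * (1 / (1 + (x - y) ^ 2) - 2 * r) := by gcongr
        _ = _ := by unfold poisson; ring
    have hh : 1 / 2 * (1 / (x ^ 2 + (4 / r) ^ 2)) ≤ 1 / (y ^ 2 + (4 / r) ^ 2) := by
      rw [one_div_mul_one_div]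
      apply one_div_le_one_div_of_le (by positivity)
      nlinarith [sq_nonneg (2 * x - y)]
    have hpos : 0 ≤ 1 / (y ^ 2 + (4 / r) ^ 2) := by positivity
    calc _ ≤ (poisson (x - y) - 2 * r / Real.pi) * (1 / (y ^ 2 + (4 / r) ^ 2)) := by gcongr
      _ = poisson (x - y) * (1 / (y ^ 2 + (4 / r) ^ 2)) -
          2 * r / Real.pi * (1 / (y ^ 2 + (4 / r) ^ 2)) := by ring
      _ ≤ poisson (x - y) * (1 / (y ^ 2 + (4 / r) ^ 2)) -
          2 * r / Real.pi * (1 / 2 * (1 / (x ^ 2 + (4 / r) ^ 2))) := by gcongr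
      _ = _ := by ring
  · rw [Set.indicator_of_notMem hy, sub_zero]
    gcongr
    exact kernel_le_poisson a x y

/-- `h(y) = 1 / (y² + (4 / r)²)` is a supersolution: `K_a h ≤ (1 - r / 12) h`. -/
theorem integral_kernel_mul_inv_le {a r : ℝ} (hr : 0 < r) (hr' : r ≤ 1 / 16)
    (har : a ^ 2 = r ^ 5) (x : ℝ) :
    ∫ y, kernel a x y * (1 / (y ^ 2 + (4 / r) ^ 2)) ≤
      (1 - 1 / 12 * r) * (1 / (x ^ 2 + (4 / r) ^ 2)) := by
  set β := 4 / r with hβ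
  have hβ64 : (64 : ℝ) ≤ β := by rw [hβ, le_div_iff₀ hr]; linarith
  have hrβ : r = 4 / β := by rw [hβ]; field_simp
  have hint := integrable_poisson_mul_inv (β := β) (by linarith) x
  have hval := integral_poisson_mul_inv (β := β) (by linarith) x
  have hintk : Integrable fun y => kernel a x y * (1 / (y ^ 2 + β ^ 2)) := by
    refine hint.mono ((((kernel_continuous a).comp (Continuous.prodMk_right x)).mul
      (continuous_inv_sq_add_sq (by linarith))).aestronglyMeasurable)
      (Eventually.of_forall fun y => ?_)
    have h1 := kernel_nonneg a x y
    have h2 := poisson_nonneg (x - y)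
    rw [Real.norm_of_nonneg (by positivity), Real.norm_of_nonneg (by positivity)]
    gcongr
    exact kernel_le_poisson a x y
  -- near the origin the Poisson kernel alone contracts `h`; far out the quartic term does
  rcases le_total (x ^ 2) (4 / r ^ 2) with hx | hx
  · have hx' : 4 * x ^ 2 ≤ β ^ 2 := by
      have : β ^ 2 = 4 * (4 / r ^ 2) := by rw [hβ]; field_simp
      linarith
    calc _ ≤ ∫ y, poisson (x - y) * (1 / (y ^ 2 + β ^ 2)) := by
          refine integral_mono hintk hint fun y => ?_
          dsimp only
          gcongr
          exact kernel_le_poisson a x y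
      _ = (β + 1) / β / (x ^ 2 + (β + 1) ^ 2) := hval
      _ ≤ _ := by
          have : (1 - 1 / 12 * r) * (1 / (x ^ 2 + β ^ 2)) =
              (3 * β - 1) / (3 * β) / (x ^ 2 + β ^ 2) := by
            rw [hrβ]; field_simp; ring
          rw [this, div_div, div_div, div_le_div_iff₀ (by positivity) (by positivity)]
          have h1 : (β + 1) * (3 * (x ^ 2 + β ^ 2)) ≤ (3 * β - 1) * (x ^ 2 + (β + 1) ^ 2) := by
            nlinarith
          have h2 := mul_le_mul_of_nonneg_left h1 (show 0 ≤ β by linarith)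
          linarith
  · have hpi := Real.pi_pos
    set h₀ := 1 / (x ^ 2 + β ^ 2) with hh₀
    have hh₀pos : 0 < h₀ := by positivity
    have hindi : Integrable ((Set.Icc (x - 1) (x + 1)).indicator
        (fun _ => r / Real.pi * h₀)) :=
      (integrable_indicator_iff measurableSet_Icc).2
        (integrableOn_const measure_Icc_lt_top.ne)
    have hindv : ∫ y, (Set.Icc (x - 1) (x + 1)).indicator (fun _ => r / Real.pi * h₀) y =
        2 * (r / Real.pi * h₀) := by
      rw [integral_indicator measurableSet_Icc, setIntegral_const,
        Real.volume_real_Icc_of_le (show x - 1 ≤ x + 1 by linarith), smul_eq_mul]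
      ring
    calc _ ≤ ∫ y, (poisson (x - y) * (1 / (y ^ 2 + β ^ 2)) -
          (Set.Icc (x - 1) (x + 1)).indicator (fun _ => r / Real.pi * h₀) y) :=
          integral_mono hintk (hint.sub hindi) fun y => by
            exact kernel_mul_inv_le_sub_indicator hr hr' har hx
      _ = (β + 1) / β / (x ^ 2 + (β + 1) ^ 2) - 2 * (r / Real.pi * h₀) := by
          rw [integral_sub hint hindi, hval, hindv]
      _ ≤ (β + 1) / β * h₀ - 2 * (r / Real.pi * h₀) := by
          have : 1 / (x ^ 2 + (β + 1) ^ 2) ≤ h₀ := by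
            apply one_div_le_one_div_of_le (by positivity)
            nlinarith
          rw [div_eq_mul_one_div ((β + 1) / β)]
          gcongr
      _ ≤ _ := by
          have h1 : (β + 1) / β = 1 + r / 4 := by rw [hrβ]; field_simp
          have h2 : r / 4 ≤ r / Real.pi := by
            apply div_le_div_of_nonneg_left hr.le hpi Real.pi_le_four
          rw [h1]
          nlinarith

theorem memLp_inv_sq_add_sq {β : ℝ} (hβ : 1 ≤ β) :
    MemLp (fun x : ℝ => ((1 / (x ^ 2 + β ^ 2) : ℝ) : ℂ)) 2 volume := by
  have hc := continuous_inv_sq_add_sq (β := β) (by linarith)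
  have hm := (Complex.continuous_ofReal.comp hc).aestronglyMeasurable (μ := volume)
  refine (memLp_two_iff_integrable_sq_norm hm).2 (integrable_inv_one_add_sq.mono (hm.norm.pow 2)
    (Eventually.of_forall fun x => ?_))
  have h0 : 0 ≤ 1 / (x ^ 2 + β ^ 2) := by positivity
  rw [Function.comp_apply, Complex.norm_real, Real.norm_of_nonneg (sq_nonneg _),
    Real.norm_of_nonneg h0,
    Real.norm_of_nonneg (by positivity), sq]
  calc _ ≤ 1 * (1 / (x ^ 2 + β ^ 2)) := by gcongr; exact inv_sq_add_sq_le hβ x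
    _ ≤ _ := by
      rw [one_mul, ← one_div]
      apply one_div_le_one_div_of_le (by positivity)
      nlinarith

theorem eigenvalue_le_one_sub {a r E : ℝ} (hr : 0 < r) (hr' : r ≤ 1 / 16) (har : a ^ 2 = r ^ 5)
    
    (hE : Module.End.HasEigenvalue (operator a).toLinearMap (E : ℂ)) : E ≤ 1 - 1 / 12 * r := by
  obtain ⟨ψ, hψ, hψ0⟩ := hE.exists_hasEigenvector
  have hβ : (64 : ℝ) ≤ 4 / r := by rw [le_div_iff₀ hr]; linarith
  exact eigenvalue_le_of_integral_kernel_mul_le (h := fun y => 1 / (y ^ 2 + (4 / r) ^ 2))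
    (fun x => by positivity) (memLp_inv_sq_add_sq (by linarith))
    (integral_kernel_mul_inv_le hr hr' har) hψ0 (Module.End.mem_eigenspace_iff.1 hψ)

/-! ### Moments of the trial function and its energy -/

/-- The moment `∫ x^j / (1 + x²)^n`. -/
def moment (j n : ℕ) : ℝ := ∫ x : ℝ, x ^ j / (1 + x ^ 2) ^ n

theorem continuous_pow_div (j n : ℕ) : Continuous fun x : ℝ => x ^ j / (1 + x ^ 2) ^ n :=
  (continuous_pow j).div (by fun_prop) fun x => by positivity

theorem abs_pow_le_one_add_sq_pow {j n : ℕ} (h : j ≤ 2 * n) (x : ℝ) :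
    |x| ^ j ≤ (1 + x ^ 2) ^ n := by
  rcases le_total |x| 1 with hx | hx
  · exact (pow_le_one₀ (abs_nonneg x) hx).trans (one_le_pow₀ (by nlinarith [sq_nonneg x]))
  · calc |x| ^ j ≤ |x| ^ (2 * n) := pow_le_pow_right₀ hx h
      _ = (x ^ 2) ^ n := by rw [pow_mul, sq_abs]
      _ ≤ _ := by gcongr; linarith

theorem integrable_pow_div {j n : ℕ} (h : j + 2 ≤ 2 * n) :
    Integrable fun x : ℝ => x ^ j / (1 + x ^ 2) ^ n := by
  obtain ⟨m, rfl⟩ : ∃ m, n = m + 1 := ⟨n - 1, by omega⟩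
  refine integrable_inv_one_add_sq.mono (continuous_pow_div j _).aestronglyMeasurable
    (Eventually.of_forall fun x => ?_)
  have h1 : 0 < 1 + x ^ 2 := by positivity
  rw [norm_div, norm_pow, Real.norm_eq_abs, Real.norm_of_nonneg (by positivity),
    Real.norm_of_nonneg (by positivity), div_le_iff₀ (by positivity), pow_succ' (1 + x ^ 2) m,
    inv_mul_cancel_left₀ h1.ne']
  exact abs_pow_le_one_add_sq_pow (by omega) x

theorem tendsto_pow_div {j n : ℕ} (h : j + 1 ≤ 2 * n) {l : Filter ℝ}
    (hinv : Tendsto (fun y : ℝ => y⁻¹) l (𝓝 0)) (hne : ∀ᶠ y in l, y ≠ 0) :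
    Tendsto (fun x : ℝ => x ^ j / (1 + x ^ 2) ^ n) l (𝓝 0) := by
  refine squeeze_zero_norm' ?_ (by simpa using hinv.norm)
  filter_upwards [hne] with x hx
  have hx' : 0 < |x| := abs_pos.2 hx
  rw [norm_div, norm_pow, Real.norm_eq_abs, Real.norm_of_nonneg (by positivity), ← one_div,
    div_le_div_iff₀ (by positivity) hx', ← pow_succ, one_mul]
  exact abs_pow_le_one_add_sq_pow h x

/-- Integration of the derivative of `x^(j+1) / (1 + x²)^n`. -/
theorem moment_recurrence {j n : ℕ} (h : j + 2 ≤ 2 * n) :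
    (j + 1) * moment j (n + 1) = (2 * n - j - 1) * moment (j + 2) (n + 1) := by
  have hF : ∀ x : ℝ, HasDerivAt (fun x : ℝ => x ^ (j + 1) / (1 + x ^ 2) ^ n)
      ((j + 1) * (x ^ j / (1 + x ^ 2) ^ (n + 1)) -
        (2 * n - j - 1) * (x ^ (j + 2) / (1 + x ^ 2) ^ (n + 1))) x := by
    intro x
    have h1 : 0 < 1 + x ^ 2 := by positivity
    obtain ⟨m, rfl⟩ : ∃ m, n = m + 1 := ⟨n - 1, by omega⟩
    have d1 : HasDerivAt (fun x : ℝ => x ^ (j + 1)) ((j + 1) * x ^ j) x := by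
      simpa using hasDerivAt_pow (j + 1) x
    have d2 : HasDerivAt (fun x : ℝ => 1 + x ^ 2) (2 * x) x := by
      simpa using (hasDerivAt_pow 2 x).const_add 1
    refine (d1.fun_div (d2.fun_pow (m + 1)) (by positivity)).congr_deriv ?_
    simp only [Nat.add_sub_cancel, Nat.cast_add, Nat.cast_one]
    field_simp
    ring
  have hi1 := (integrable_pow_div (j := j) (n := n + 1) (by omega)).const_mul ((j : ℝ) + 1)
  have hi2 := (integrable_pow_div (j := j + 2) (n := n + 1) (by omega)).const_mul
    ((2 : ℝ) * n - j - 1)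
  have h0 := integral_of_hasDerivAt_of_tendsto hF (hi1.sub hi2)
    (tendsto_pow_div (by omega) tendsto_inv_atBot_zero (eventually_ne_atBot 0))
    (tendsto_pow_div (by omega) tendsto_inv_atTop_zero (eventually_ne_atTop 0))
  rw [integral_sub hi1 hi2, integral_const_mul, integral_const_mul, sub_self] at h0
  exact sub_eq_zero.1 h0

theorem moment_add_moment {j n : ℕ} (h : j + 2 ≤ 2 * n) :
    moment j n = moment j (n + 1) + moment (j + 2) (n + 1) := by
  rw [moment, moment, moment, ← integral_add (integrable_pow_div (by omega))
    (integrable_pow_div (by omega))]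
  refine integral_congr_ae (Eventually.of_forall fun x => ?_)
  have h1 : 0 < 1 + x ^ 2 := by positivity
  field_simp
  ring

theorem moment_zero_one : moment 0 1 = Real.pi := by
  rw [← integral_univ_inv_one_add_sq, moment]
  simp

theorem moment_zero_succ {n : ℕ} (h : 1 ≤ n) :
    2 * n * moment 0 (n + 1) = (2 * n - 1) * moment 0 n := by
  have h1 := moment_recurrence (j := 0) (n := n) (by omega)
  have h2 := moment_add_moment (j := 0) (n := n) (by omega)
  rw [h2]
  push_cast at h1
  linarith

theorem moment_zero_two : moment 0 2 = Real.pi / 2 := by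
  have h := moment_zero_succ (n := 1) le_rfl
  rw [moment_zero_one] at h
  norm_num at h
  linarith

theorem moment_odd {j : ℕ} (hj : Odd j) (n : ℕ) : moment j n = 0 := by
  have h : moment j n = -moment j n := by
    conv_lhs => rw [moment, ← integral_neg_eq_self]
    rw [moment, ← integral_neg]
    refine integral_congr_ae (Eventually.of_forall fun x => ?_)
    simp [hj.neg_pow, neg_div]
  linarith

/-- The integers `256 / π · ∫ x^k / (1 + x²)⁶` for `k ≤ 10`. -/
def momentCoeff (k : ℕ) : ℤ :=
  match k with
  | 0 => 63
  | 2 => 7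
  | 4 => 3
  | 6 => 3
  | 8 => 7
  | 10 => 63
  | _ => 0

theorem moment_six {k : ℕ} (hk : k ≤ 10) : moment k 6 = Real.pi / 256 * momentCoeff k := by
  have h1 := moment_zero_succ (n := 2) (by norm_num)
  have h2 := moment_zero_succ (n := 3) (by norm_num)
  have h3 := moment_zero_succ (n := 4) (by norm_num)
  have h4 := moment_zero_succ (n := 5) (by norm_num)
  have r0 := moment_recurrence (j := 0) (n := 5) (by norm_num)
  have r2 := moment_recurrence (j := 2) (n := 5) (by norm_num)
  have r4 := moment_recurrence (j := 4) (n := 5) (by norm_num)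
  have r6 := moment_recurrence (j := 6) (n := 5) (by norm_num)
  have r8 := moment_recurrence (j := 8) (n := 5) (by norm_num)
  rw [moment_zero_two] at h1
  norm_num at h1 h2 h3 h4 r0 r2 r4 r6 r8
  rcases Nat.even_or_odd k with he | ho
  · obtain ⟨m, rfl⟩ := he
    have hm : m ≤ 5 := by omega
    interval_cases m <;> norm_num [momentCoeff] <;> linarith
  · rw [moment_odd ho]
    obtain ⟨m, rfl⟩ := ho
    have hm : m ≤ 4 := by omega
    interval_cases m <;> norm_num [momentCoeff]

/-- The odd profile `g(s) = s / (1 + s²)³`. -/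
def profile (s : ℝ) : ℝ := s / (1 + s ^ 2) ^ 3

/-- Coefficients of the polynomial `N` with
`s (1 + t²)³ - t (1 + s²)³ = (s - t) N(s, t)`. -/
def slopeCoeff (i k : ℕ) : ℤ :=
  if i = 0 ∧ k = 0 then 1
  else if i = 0 ∨ k = 0 then 0
  else if i + k = 2 ∨ i + k = 4 then -3
  else if i + k = 6 then -1
  else 0

/-- The divided difference `(g(s) - g(t)) / (s - t)` of the profile, extended continuously to the
diagonal. -/
def profileSlope (s t : ℝ) : ℝ :=
  ∑ p ∈ Finset.range 6 ×ˢ Finset.range 6,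
    (slopeCoeff p.1 p.2 : ℝ) * (s ^ p.1 / (1 + s ^ 2) ^ 3 * (t ^ p.2 / (1 + t ^ 2) ^ 3))

theorem profile_sub_profile (s t : ℝ) :
    profile s - profile t = (s - t) * profileSlope s t := by
  have hs : 0 < 1 + s ^ 2 := by positivity
  have ht : 0 < 1 + t ^ 2 := by positivity
  rw [profileSlope, Finset.sum_product]
  simp only [Finset.sum_range_succ, Finset.sum_range_zero, slopeCoeff]
  norm_num [profile]
  field_simp
  ring

theorem profileSlope_sq (s t : ℝ) :
    profileSlope s t ^ 2 =
      ∑ p ∈ Finset.range 6 ×ˢ Finset.range 6, ∑ q ∈ Finset.range 6 ×ˢ Finset.range 6,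
        (slopeCoeff p.1 p.2 * slopeCoeff q.1 q.2 : ℝ) *
          (s ^ (p.1 + q.1) / (1 + s ^ 2) ^ 6 * (t ^ (p.2 + q.2) / (1 + t ^ 2) ^ 6)) := by
  rw [sq, profileSlope, Finset.sum_mul_sum]
  refine Finset.sum_congr rfl fun p _ => Finset.sum_congr rfl fun q _ => ?_
  rw [pow_add, pow_add]
  have hs : 0 < 1 + s ^ 2 := by positivity
  have ht : 0 < 1 + t ^ 2 := by positivity
  field_simp

/-- The value, in units of `(π / 256)²`, of the double integral of the squared divided difference. -/
theorem sum_slopeCoeff_mul_momentCoeff :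
    ∑ p ∈ Finset.range 6 ×ˢ Finset.range 6, ∑ q ∈ Finset.range 6 ×ˢ Finset.range 6,
      slopeCoeff p.1 p.2 * slopeCoeff q.1 q.2 *
        (momentCoeff (p.1 + q.1) * momentCoeff (p.2 + q.2)) = 7680 := by
  decide +kernel

theorem integrable_scaled_pow_div {β : ℝ} (hβ : 0 < β) {k : ℕ} (hk : k ≤ 10) :
    Integrable fun x : ℝ => (x / β) ^ k / (1 + (x / β) ^ 2) ^ 6 :=
  (integrable_pow_div (j := k) (n := 6) (by omega)).comp_div hβ.ne'

theorem integral_scaled_pow_div {β : ℝ} (hβ : 0 < β) {k : ℕ} (hk : k ≤ 10) :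
    ∫ x : ℝ, (x / β) ^ k / (1 + (x / β) ^ 2) ^ 6 = β * (Real.pi / 256 * momentCoeff k) := by
  rw [Measure.integral_comp_div (fun x : ℝ => x ^ k / (1 + x ^ 2) ^ 6) β, abs_of_pos hβ,
    smul_eq_mul, ← moment_six hk, moment]

theorem integrable_profileSlope_sq {β : ℝ} (hβ : 0 < β) :
    Integrable (fun z : ℝ × ℝ => profileSlope (z.1 / β) (z.2 / β) ^ 2) (volume.prod volume) := by
  simp_rw [profileSlope_sq]
  refine integrable_finsetSum _ fun p hp => integrable_finsetSum _ fun q hq => ?_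
  simp only [Finset.mem_product, Finset.mem_range] at hp hq
  exact ((integrable_scaled_pow_div hβ (by omega)).mul_prod
    (integrable_scaled_pow_div hβ (by omega))).const_mul _

theorem integral_profileSlope_sq {β : ℝ} (hβ : 0 < β) :
    ∫ z : ℝ × ℝ, profileSlope (z.1 / β) (z.2 / β) ^ 2 ∂(volume.prod volume) =
      β ^ 2 * (30 * Real.pi ^ 2 / 256) := by
  simp_rw [profileSlope_sq]
  have hint : ∀ p ∈ Finset.range 6 ×ˢ Finset.range 6, ∀ q ∈ Finset.range 6 ×ˢ Finset.range 6,
      Integrable (fun z : ℝ × ℝ => (slopeCoeff p.1 p.2 * slopeCoeff q.1 q.2 : ℝ) *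
          ((z.1 / β) ^ (p.1 + q.1) / (1 + (z.1 / β) ^ 2) ^ 6 *
            ((z.2 / β) ^ (p.2 + q.2) / (1 + (z.2 / β) ^ 2) ^ 6))) (volume.prod volume) := by
    intro p hp q hq
    simp only [Finset.mem_product, Finset.mem_range] at hp hq
    exact ((integrable_scaled_pow_div hβ (by omega)).mul_prod
      (integrable_scaled_pow_div hβ (by omega))).const_mul _
  rw [integral_finsetSum _ fun p hp => integrable_finsetSum _ fun q hq => hint p hp q hq]
  have hterm : ∀ p ∈ Finset.range 6 ×ˢ Finset.range 6,
      ∫ z : ℝ × ℝ, ∑ q ∈ Finset.range 6 ×ˢ Finset.range 6,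
        (slopeCoeff p.1 p.2 * slopeCoeff q.1 q.2 : ℝ) *
          ((z.1 / β) ^ (p.1 + q.1) / (1 + (z.1 / β) ^ 2) ^ 6 *
            ((z.2 / β) ^ (p.2 + q.2) / (1 + (z.2 / β) ^ 2) ^ 6)) ∂(volume.prod volume) =
      ∑ q ∈ Finset.range 6 ×ˢ Finset.range 6, (β * (Real.pi / 256)) ^ 2 *
        ((slopeCoeff p.1 p.2 * slopeCoeff q.1 q.2 *
        (momentCoeff (p.1 + q.1) * momentCoeff (p.2 + q.2)) : ℤ) : ℝ) := by
    intro p hp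
    rw [integral_finsetSum _ fun q hq => hint p hp q hq]
    refine Finset.sum_congr rfl fun q hq => ?_
    simp only [Finset.mem_product, Finset.mem_range] at hp hq
    rw [integral_const_mul,
      integral_prod_mul (fun x : ℝ => (x / β) ^ (p.1 + q.1) / (1 + (x / β) ^ 2) ^ 6)
        (fun x : ℝ => (x / β) ^ (p.2 + q.2) / (1 + (x / β) ^ 2) ^ 6),
      integral_scaled_pow_div hβ (by omega), integral_scaled_pow_div hβ (by omega)]
    push_cast
    ring
  rw [Finset.sum_congr rfl hterm]
  simp_rw [← Finset.mul_sum]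
  have := congrArg (Int.cast : ℤ → ℝ) sum_slopeCoeff_mul_momentCoeff
  push_cast at this ⊢
  rw [this]
  ring

/-- `(x, y) ↦ w(x - y) φ(y)` is a product function composed with a measure-preserving shear. -/
theorem integrable_sub_mul_snd {w φ : ℝ → ℝ} (hw : Integrable w) (hφ : Integrable φ) :
    Integrable (fun z : ℝ × ℝ => w (z.1 - z.2) * φ z.2) (volume.prod volume) :=
  (measurePreserving_sub_prod (volume : Measure ℝ)
    (volume : Measure ℝ)).integrable_comp_of_integrable (hw.mul_prod hφ)

theorem integral_sub_mul_snd {w φ : ℝ → ℝ} (hw : Integrable w) (hφ : Integrable φ) :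
    ∫ z : ℝ × ℝ, w (z.1 - z.2) * φ z.2 ∂(volume.prod volume) = (∫ u, w u) * ∫ x, φ x := by
  have h := measurePreserving_sub_prod (volume : Measure ℝ) (volume : Measure ℝ)
  rw [← integral_prod_mul w φ]
  nth_rewrite 2 [← h.map_eq]
  rw [integral_map h.measurable.aemeasurable]
  rw [h.map_eq]
  exact (hw.mul_prod hφ).aestronglyMeasurable

theorem integrable_sub_mul_add {w φ : ℝ → ℝ} (hw : Integrable w) (heven : ∀ u, w (-u) = w u)
    (hφ : Integrable φ) :
    Integrable (fun z : ℝ × ℝ => w (z.1 - z.2) * (φ z.1 + φ z.2)) (volume.prod volume) := by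
  have h := integrable_sub_mul_snd hw hφ
  refine (h.swap.add h).congr (Eventually.of_forall fun z => ?_)
  simp only [Pi.add_apply, Function.comp_apply, Prod.fst_swap, Prod.snd_swap]
  rw [← neg_sub z.1 z.2, heven]
  ring

theorem integral_sub_mul_add {w φ : ℝ → ℝ} (hw : Integrable w) (heven : ∀ u, w (-u) = w u)
    (hφ : Integrable φ) :
    ∫ z : ℝ × ℝ, w (z.1 - z.2) * (φ z.1 + φ z.2) ∂(volume.prod volume) =
      2 * ((∫ u, w u) * ∫ x, φ x) := by
  have h := integrable_sub_mul_snd hw hφ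
  have h1 : ∀ z : ℝ × ℝ, w (z.1 - z.2) * (φ z.1 + φ z.2) =
      w (z.swap.1 - z.swap.2) * φ z.swap.2 + w (z.1 - z.2) * φ z.2 := by
    intro z
    rw [Prod.fst_swap, Prod.snd_swap, ← neg_sub z.1 z.2, heven]
    ring
  simp_rw [h1]
  refine (integral_add h.swap h).trans ?_
  simp only [Function.comp_def]
  rw [integral_prod_swap (fun z : ℝ × ℝ => w (z.1 - z.2) * φ z.2), integral_sub_mul_snd hw hφ]
  ring

/-- The kernel `Q(u) = 1 / (π (1 + u²)²)`, of total mass `1/2`. -/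
def poissonSq (u : ℝ) : ℝ := 1 / Real.pi * (1 / (1 + u ^ 2) ^ 2)

theorem integrable_poissonSq : Integrable poissonSq := by
  refine ((integrable_pow_div (j := 0) (n := 2) (by norm_num)).const_mul (1 / Real.pi)).congr
    (Eventually.of_forall fun u => ?_)
  simp [poissonSq]

theorem integral_poissonSq : ∫ u, poissonSq u = 1 / 2 := by
  have : poissonSq = fun u => 1 / Real.pi * (u ^ 0 / (1 + u ^ 2) ^ 2) := by
    funext u; simp [poissonSq]
  rw [this, integral_const_mul]
  change 1 / Real.pi * moment 0 2 = 1 / 2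
  rw [moment_zero_two]
  have := Real.pi_pos
  field_simp

/-- The pointwise lower bound for the form. With `p = f(x)`, `q = f(y)`, one writes
`2 p q = p² + q² - (p - q)²` in the Poisson part, and bounds the loss `P - K_a` through
`(x² + y²)² = 4 x² y² + (x - y)² (x + y)²`. The first of these gives the main term `2 a² x⁴`, the
second a term of lower order; `l` balances the latter. -/
theorem kernel_mul_ge (a x y p q w l : ℝ) (hl : 0 < l)
    (hw : (p - q) ^ 2 ≤ (x - y) ^ 2 * w) (hw0 : 0 ≤ w) :
    1 / 2 * (poisson (x - y) * (p ^ 2 + q ^ 2)) - 1 / (2 * Real.pi) * w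
      - 2 * a ^ 2 * (poissonSq (x - y) * (x ^ 4 * p ^ 2 + y ^ 4 * q ^ 2))
      - a ^ 2 / l * (poisson (x - y) * (x ^ 4 * p ^ 2 + y ^ 4 * q ^ 2))
      - a ^ 2 * l * (poisson (x - y) * (p ^ 2 + q ^ 2)) ≤ kernel a x y * (p * q) := by
  have hpi := Real.pi_pos
  set v := (x - y) ^ 2 with hv
  have hv0 : 0 ≤ v := sq_nonneg _
  set A := a ^ 2 * (x ^ 2 + y ^ 2) ^ 2 with hA
  have hA0 : 0 ≤ A := by positivity
  -- the energy of the difference `p - q`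
  have h1 : poisson (x - y) * (p - q) ^ 2 ≤ 1 / Real.pi * w := by
    unfold poisson
    rw [mul_assoc]
    gcongr
    rw [one_div, inv_mul_le_iff₀ (by positivity)]
    nlinarith
  -- the loss `P - K_a`
  have h2 : (poisson (x - y) - kernel a x y) * |p * q| ≤
      1 / Real.pi * (A * |p * q| / (1 + v) ^ 2) := by
    have : poisson (x - y) - kernel a x y ≤ 1 / Real.pi * (A / (1 + v) ^ 2) := by
      unfold poisson kernel
      rw [← mul_sub]
      gcongr
      rw [div_sub_div _ _ (by positivity) (by positivity), div_le_div_iff₀ (by positivity)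
        (by positivity)]
      have : 0 ≤ A * ((1 + v) * A) := by positivity
      nlinarith
    calc _ ≤ 1 / Real.pi * (A / (1 + v) ^ 2) * |p * q| := by gcongr
      _ = _ := by ring
  have hpq : |p * q| = |p| * |q| := abs_mul p q
  have h3 : 4 * (x ^ 2 * y ^ 2) * |p * q| ≤ 2 * (x ^ 4 * p ^ 2 + y ^ 4 * q ^ 2) := by
    rw [hpq, ← sq_abs p, ← sq_abs q]
    nlinarith [sq_nonneg (x ^ 2 * |p| - y ^ 2 * |q|)]
  have h4 : (x + y) ^ 2 * |p * q| ≤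
      (x ^ 4 * p ^ 2 + y ^ 4 * q ^ 2) / l + l * (p ^ 2 + q ^ 2) := by
    have e1 : 2 * (x ^ 2 * |p| * |q|) ≤ x ^ 4 * p ^ 2 / l + l * q ^ 2 := by
      rw [div_add' _ _ _ hl.ne', le_div_iff₀ hl, ← sq_abs p, ← sq_abs q]
      nlinarith [sq_nonneg (x ^ 2 * |p| - l * |q|)]
    have e2 : 2 * (y ^ 2 * |p| * |q|) ≤ y ^ 4 * q ^ 2 / l + l * p ^ 2 := by
      rw [div_add' _ _ _ hl.ne', le_div_iff₀ hl, ← sq_abs p, ← sq_abs q]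
      nlinarith [sq_nonneg (y ^ 2 * |q| - l * |p|)]
    have e3 : (x + y) ^ 2 * (|p| * |q|) ≤ 2 * (x ^ 2 + y ^ 2) * (|p| * |q|) := by
      gcongr
      nlinarith [sq_nonneg (x - y)]
    rw [hpq, add_div]
    linarith
  have h5 : A * |p * q| / (1 + v) ^ 2 ≤
      a ^ 2 * (2 * (x ^ 4 * p ^ 2 + y ^ 4 * q ^ 2)) * (1 / (1 + v) ^ 2) +
      a ^ 2 * ((x ^ 4 * p ^ 2 + y ^ 4 * q ^ 2) / l + l * (p ^ 2 + q ^ 2)) * (1 / (1 + v)) := by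
    have hsplit : A * |p * q| / (1 + v) ^ 2 =
        a ^ 2 * (4 * (x ^ 2 * y ^ 2) * |p * q|) * (1 / (1 + v) ^ 2) +
        a ^ 2 * ((x + y) ^ 2 * |p * q|) * (v / (1 + v) ^ 2) := by
      rw [hA, hv]
      ring
    have hvle : v / (1 + v) ^ 2 ≤ 1 / (1 + v) := by
      rw [div_le_div_iff₀ (by positivity) (by positivity)]
      nlinarith
    rw [hsplit]
    gcongr
  have h6 : (poisson (x - y) - kernel a x y) * (p * q) ≤
      (poisson (x - y) - kernel a x y) * |p * q| := by
    apply mul_le_mul_of_nonneg_left (le_abs_self _)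
    linarith [kernel_le_poisson a x y]
  have h7 := mul_le_mul_of_nonneg_left h5 (show 0 ≤ 1 / Real.pi by positivity)
  have e1 : 1 / Real.pi * (a ^ 2 * (2 * (x ^ 4 * p ^ 2 + y ^ 4 * q ^ 2)) * (1 / (1 + v) ^ 2) +
      a ^ 2 * ((x ^ 4 * p ^ 2 + y ^ 4 * q ^ 2) / l + l * (p ^ 2 + q ^ 2)) * (1 / (1 + v))) =
      2 * a ^ 2 * (poissonSq (x - y) * (x ^ 4 * p ^ 2 + y ^ 4 * q ^ 2))
      + a ^ 2 / l * (poisson (x - y) * (x ^ 4 * p ^ 2 + y ^ 4 * q ^ 2))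
      + a ^ 2 * l * (poisson (x - y) * (p ^ 2 + q ^ 2)) := by
    unfold poissonSq poisson
    rw [← hv]
    ring
  have e2 : poisson (x - y) * (p * q) = 1 / 2 * (poisson (x - y) * (p ^ 2 + q ^ 2)) -
      1 / 2 * (poisson (x - y) * (p - q) ^ 2) := by ring
  have e3 : 1 / (2 * Real.pi) * w = 1 / 2 * (1 / Real.pi * w) := by field_simp
  rw [e1] at h7
  linarith

theorem integrable_profile_sq {β : ℝ} (hβ : 0 < β) : Integrable fun x => profile (x / β) ^ 2 := by
  refine (integrable_scaled_pow_div hβ (k := 2) (by norm_num)).congr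
    (Eventually.of_forall fun x => ?_)
  simp only [profile, div_pow _ ((1 + _ : ℝ) ^ 3), ← pow_mul]

theorem integral_profile_sq {β : ℝ} (hβ : 0 < β) :
    ∫ x, profile (x / β) ^ 2 = 7 * Real.pi / 256 * β := by
  have h := integral_scaled_pow_div hβ (k := 2) (by norm_num)
  norm_num [momentCoeff] at h
  rw [show 7 * Real.pi / 256 * β = β * (Real.pi / 256 * 7) by ring, ← h]
  refine integral_congr_ae (Eventually.of_forall fun x => ?_)
  simp only [profile, div_pow _ ((1 + _ : ℝ) ^ 3), ← pow_mul]

theorem quartic_mul_profile_sq {β : ℝ} (hβ : 0 < β) (x : ℝ) :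
    x ^ 4 * profile (x / β) ^ 2 = β ^ 4 * ((x / β) ^ 6 / (1 + (x / β) ^ 2) ^ 6) := by
  have hx : x = β * (x / β) := by field_simp
  generalize x / β = s at hx
  subst hx
  rw [profile, div_pow, ← pow_mul]
  ring

theorem integrable_quartic_mul_profile_sq {β : ℝ} (hβ : 0 < β) :
    Integrable fun x => x ^ 4 * profile (x / β) ^ 2 := by
  simp_rw [quartic_mul_profile_sq hβ]
  exact (integrable_scaled_pow_div hβ (by norm_num)).const_mul _

theorem integral_quartic_mul_profile_sq {β : ℝ} (hβ : 0 < β) :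
    ∫ x, x ^ 4 * profile (x / β) ^ 2 = 3 * Real.pi / 256 * β ^ 5 := by
  simp_rw [quartic_mul_profile_sq hβ]
  rw [integral_const_mul, integral_scaled_pow_div hβ (by norm_num)]
  norm_num [momentCoeff]
  ring

/-- The form at the trial function of width `β`: `7 β` stems from its norm, `15` from the energy
`|p|`, `6 a² β⁵` from the quartic potential, and `20 a² β³` is of lower order when `β ~ a^(-2/5)`. -/
theorem le_integral_kernel_mul_profile {a β : ℝ} (hβ : 0 < β)
    (hint : Integrable (fun z : ℝ × ℝ => kernel a z.1 z.2 * (profile (z.1 / β) * profile (z.2 / β)))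
      (volume.prod volume)) :
    Real.pi / 256 * (7 * β - 15 - 6 * a ^ 2 * β ^ 5 - 20 * a ^ 2 * β ^ 3) ≤
      ∫ z : ℝ × ℝ, kernel a z.1 z.2 * (profile (z.1 / β) * profile (z.2 / β))
        ∂(volume.prod volume) := by
  have hpi := Real.pi_pos
  have hPe : ∀ u, poisson (-u) = poisson u := fun u => by simp [poisson]
  have hQe : ∀ u, poissonSq (-u) = poissonSq u := fun u => by simp [poissonSq]
  have hm0 := integrable_profile_sq hβ
  have hm4 := integrable_quartic_mul_profile_sq hβ
  have i1 := (integrable_sub_mul_add integrable_poisson hPe hm0).const_mul (1 / 2)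
  have i2 := (integrable_profileSlope_sq hβ).const_mul (1 / (2 * Real.pi) * (1 / β ^ 2))
  have i3 := (integrable_sub_mul_add integrable_poissonSq hQe hm4).const_mul (2 * a ^ 2)
  have i4 := (integrable_sub_mul_add integrable_poisson hPe hm4).const_mul (a ^ 2 / β ^ 2)
  have i5 := (integrable_sub_mul_add integrable_poisson hPe hm0).const_mul (a ^ 2 * β ^ 2)
  have hmono := integral_mono ((((i1.sub i2).sub i3).sub i4).sub i5) hint fun z => by
    have hdiff := profile_sub_profile (z.1 / β) (z.2 / β)
    have := kernel_mul_ge a z.1 z.2 (profile (z.1 / β)) (profile (z.2 / β))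
      (1 / β ^ 2 * profileSlope (z.1 / β) (z.2 / β) ^ 2) (β ^ 2) (by positivity)
      (by rw [hdiff, ← sub_div]; apply le_of_eq; ring) (by positivity)
    simp only [Pi.sub_apply]
    rwa [mul_assoc (1 / (2 * Real.pi))]
  refine le_trans (le_of_eq ?_) hmono
  rw [integral_sub' (((i1.sub i2).sub i3).sub i4) i5, integral_sub' ((i1.sub i2).sub i3) i4,
    integral_sub' (i1.sub i2) i3, integral_sub' i1 i2]
  simp only [integral_const_mul]
  rw [integral_sub_mul_add integrable_poisson hPe hm0,
    integral_sub_mul_add integrable_poisson hPe hm4,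
    integral_sub_mul_add integrable_poissonSq hQe hm4, integral_profileSlope_sq hβ,
    integral_poisson, integral_poissonSq, integral_profile_sq hβ,
    integral_quartic_mul_profile_sq hβ]
  field_simp
  ring

/-! ### The trial state and the theorem -/

theorem continuous_profile_div (β : ℝ) : Continuous fun x => profile (x / β) := by
  unfold profile
  exact Continuous.div (by fun_prop) (by fun_prop) fun x => by positivity

theorem memLp_profile {β : ℝ} (hβ : 0 < β) :
    MemLp (fun x => (profile (x / β) : ℂ)) 2 volume := by
  have hm := (Complex.continuous_ofReal.comp (continuous_profile_div β)).aestronglyMeasurable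
    (μ := volume)
  refine (memLp_two_iff_integrable_sq_norm hm).2 ((integrable_profile_sq hβ).congr
    (Eventually.of_forall fun x => ?_))
  simp

/-- The scaled profile as an odd element of `L²(ℝ)`, with its norm and a bound for its form. -/
theorem exists_odd_trial_function {a β : ℝ} (hβ : 0 < β) :
    ∃ f ∈ oddSubspace, ‖f‖ ^ 2 = 7 * Real.pi / 256 * β ∧
      Real.pi / 256 * (7 * β - 15 - 6 * a ^ 2 * β ^ 5 - 20 * a ^ 2 * β ^ 3) ≤
        (inner ℂ (operator a f) f).re := by
  set f : L2 := (memLp_profile hβ).toLp _ with hf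
  have hae : f =ᵐ[volume] fun x => (profile (x / β) : ℂ) := MemLp.coeFn_toLp _
  refine ⟨f, ?_, ?_, ?_⟩
  · change ∀ᵐ x : ℝ, f (-x) = -1 * f x
    filter_upwards [hae, ae_neg hae] with x h1 h2
    rw [h1, h2]
    simp [profile, neg_div]
  · rw [norm_sq_eq_integral, ← integral_profile_sq hβ]
    refine integral_congr_ae ?_
    filter_upwards [hae] with x hx
    simp [hx]
  · have hint : Integrable (fun z : ℝ × ℝ =>
        kernel a z.1 z.2 * (profile (z.1 / β) * profile (z.2 / β))) (volume.prod volume) := by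
      have h := (integrable_kernel_prod a f f).re
      refine h.congr ?_
      filter_upwards [Measure.quasiMeasurePreserving_fst.ae_eq_comp hae,
        Measure.quasiMeasurePreserving_snd.ae_eq_comp hae] with z h1 h2
      simp only [Function.comp_apply] at h1 h2
      rw [h1, h2, Complex.conj_ofReal, ← Complex.ofReal_mul, ← Complex.ofReal_mul]
      simp only [RCLike.re_to_complex, Complex.ofReal_re]
      ring
    refine (le_integral_kernel_mul_profile hβ hint).trans (le_of_eq ?_)
    have hs : inner ℂ (operator a f) f = inner ℂ f (operator a f) := operator_isSymmetric a f f
    have h : ∫ x, kernelIntegral a f x * (starRingEnd ℂ) (f x) =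
        ((∫ x, ∫ y, kernel a x y * (profile (x / β) * profile (y / β)) : ℝ) : ℂ) := by
      rw [← integral_complex_ofReal]
      refine integral_congr_ae ?_
      filter_upwards [hae] with x hx
      rw [hx, kernelIntegral_congr hae, Complex.conj_ofReal, kernelIntegral, ← integral_mul_const,
        ← integral_complex_ofReal]
      refine integral_congr_ae (Eventually.of_forall fun y => ?_)
      push_cast
      ring
    rw [integral_prod _ hint, hs, inner_operator, h, Complex.ofReal_re]

/-- The width `β = (9 / 10) / r` is close to the minimiser of `15 / (7 b) + (6 / 7) b⁴`, `b = r β`,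
whose minimum is just below `3`. -/
theorem exists_odd_rayleigh_ge {a r : ℝ} (hr : 0 < r) (hr' : r ≤ 1 / 16) (har : a ^ 2 = r ^ 5) :
    ∃ f ∈ oddSubspace, 0 < ‖f‖ ^ 2 ∧ (1 - 3 * r) * ‖f‖ ^ 2 ≤ (inner ℂ (operator a f) f).re := by
  obtain ⟨f, hf, hn, hle⟩ := exists_odd_trial_function (a := a) (β := 9 / 10 / r) (by positivity)
  have hpi := Real.pi_pos
  refine ⟨f, hf, by rw [hn]; positivity, le_trans ?_ hle⟩
  have e1 : a ^ 2 * (9 / 10 / r) ^ 5 = (9 / 10) ^ 5 := by rw [har]; field_simp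
  have e2 : a ^ 2 * (9 / 10 / r) ^ 3 = (9 / 10) ^ 3 * r ^ 2 := by rw [har]; field_simp
  have e3 : r * (9 / 10 / r) = 9 / 10 := by field_simp
  have hr2 : r ^ 2 ≤ (1 / 16) ^ 2 := by gcongr
  have key : (1 - 3 * r) * (7 * (9 / 10 / r)) ≤
      7 * (9 / 10 / r) - 15 - 6 * a ^ 2 * (9 / 10 / r) ^ 5 - 20 * a ^ 2 * (9 / 10 / r) ^ 3 := by
    rw [mul_assoc 6, mul_assoc 20, e1, e2]
    linarith
  rw [hn]
  calc _ = Real.pi / 256 * ((1 - 3 * r) * (7 * (9 / 10 / r))) := by ring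
    _ ≤ _ := by gcongr

end AnisotropicKernel

end

theorem theorem8 :
    ∃ a₀ : ℝ, 0 < a₀ ∧ ∀ a : ℝ, 0 < a → a < a₀ →
      ∃ E Ee Eo : ℝ,
        AnisotropicKernel.IsLargestEigenvalue (AnisotropicKernel.operator a).toLinearMap E ∧
        E = ‖AnisotropicKernel.operator a‖ ∧
        AnisotropicKernel.IsLargestEigenvalue (AnisotropicKernel.evenOperator a) Ee ∧
        AnisotropicKernel.IsLargestEigenvalue (AnisotropicKernel.oddOperator a) Eo ∧
        3 * a ^ (2 / 5 : ℝ) ≥ 1 - Eo ∧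
        1 - Eo > 1 - Ee ∧
        1 - Ee = 1 - E ∧
        1 - E ≥ 1 / 12 * a ^ (2 / 5 : ℝ) := by
  refine ⟨(1 / 16 : ℝ) ^ (5 / 2 : ℝ), by positivity, fun a ha ha₀ => ?_⟩
  set r := a ^ (2 / 5 : ℝ) with hr
  have hr0 : 0 < r := by positivity
  have hr' : r ≤ 1 / 16 := by
    have h := Real.rpow_le_rpow ha.le ha₀.le (show (0 : ℝ) ≤ 2 / 5 by norm_num)
    rw [← Real.rpow_mul (by norm_num)] at h
    norm_num at h
    norm_num
    exact h
  have har : a ^ 2 = r ^ 5 := by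
    rw [hr, ← Real.rpow_natCast, ← Real.rpow_natCast, ← Real.rpow_mul ha.le]
    norm_num
  obtain ⟨f, hf, hf0, hfle⟩ := AnisotropicKernel.exists_odd_rayleigh_ge hr0 hr' har
  have hpos : 0 < (1 - 3 * r) * ‖f‖ ^ 2 := mul_pos (by linarith) hf0
  obtain ⟨E, Eo, h1, h2, h3, h4, h5, h6⟩ :=
    AnisotropicKernel.exists_largest_eigenvalues ha ⟨f, hf, hpos.trans_le hfle⟩
  refine ⟨E, E, Eo, h1, h2, h3, h4, ?_, by linarith, rfl, ?_⟩
  · have := le_of_mul_le_mul_right (hfle.trans (h6 f hf)) hf0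
    linarith
  · have := AnisotropicKernel.eigenvalue_le_one_sub hr0 hr' har h1.1
    linarith
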